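/- For $A\subseteq\mathbb N$ and a real number $\delta$, say that $A$ has density $\delta$ if $\lim_{N\to\infty}\frac1N\,|A\cap\{1,\dots,N\}|=\delta$. Call a set $S\subseteq\mathbb N$ stable if for every prime $p$ the set of $n\in\mathbb N$ for which exactly one of $n\in S$ and $pn\in S$ holds has density $0$. For an integer $j\ge 0$ write $S+j=\{n+j:n\in S\}$. Theorem. For every prime $q$ there is a stable set $S\subseteq\mathbb N$ of density $1-\frac1{q-1}$ such that $$S\cap(S+1)\cap\dots\cap(S+q-1)$$ has density $0$. Moreover, for every prime $q$ there is a stable set $S'\subseteq\mathbb N$ of density $1-\frac1{q-1}$ such that $$S'\cap(S'+1)\cap\dots\cap(S'+q-1)=\emptyset .$$ -/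

import Mathlib

namespace StableSet

/-- `A ⊆ ℕ` has natural (asymptotic) density `δ`:
`|A ∩ {1, …, N}| / N → δ` as `N → ∞`. -/
def HasDensity (A : Set ℕ) (δ : ℝ) : Prop :=
  Filter.Tendsto (fun N : ℕ => ((A ∩ Set.Icc 1 N).ncard : ℝ) / (N : ℝ))
    Filter.atTop (nhds δ)

/-- `S` is stable: for every prime `p`, the set of `n` such that exactly one of
`n ∈ S`, `p * n ∈ S` holds has density `0`. -/
def IsStable (S : Set ℕ) : Prop :=
  ∀ p : ℕ, p.Prime → HasDensity {n : ℕ | ¬ (n ∈ S ↔ p * n ∈ S)} 0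

/-- The translate `S + j = {n + j : n ∈ S}`. -/
def translate (S : Set ℕ) (j : ℕ) : Set ℕ := (fun n => n + j) '' S

/-- `S ∩ (S + 1) ∩ ⋯ ∩ (S + (k - 1))`. -/
def consecutiveInter (S : Set ℕ) (k : ℕ) : Set ℕ :=
  ⋂ j ∈ Finset.range k, translate S j

end StableSet

/-! Let χ(n) be the last nonzero digit of n in base q. It is completely multiplicative on positive
integers, with values in the cyclic group (ℤ/q)ˣ. Suppose h : ℕ → (ℤ/q)ˣ satisfies h(n+1) = h(n)
and, for each prime p, h(pn) = χ(p)h(n), always off sets of density zero. Then T = {χ = h} is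
stable, since passing from n to pn multiplies both sides by χ(p), and it has density 1/(q-1)
(`hasDensity_lastDigit`). If h is constant with value v on q consecutive positive integers, the one
congruent to v mod q has last digit v, hence lies in T. So the complement of T contains almost no
block of length q, and deleting a null set from it removes them all (`exists_stable_of_twisted`).

To find h, fix a generator γ. Kronecker's theorem gives c ≥ 1 such that, for finitely many primes p,
c log p is within ε of an integer m with γ^m = χ(p) (`exists_scale`). Then n ↦ γ^⌊c log n⌋ has both
properties for these primes, except where c log n is within ε of an integer or n is small: a set of
upper density O(ε). To reach all primes, c must vary with n. The functions for c_k and c_{k+1} are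
unrelated, so `blend` passes from one to the other gradually. It chooses by the fractional part of
c_k log n, which n ↦ pn and n ↦ n+1 hardly change. Each small step alters the function on a set of
small upper density, and `exists_glue` takes the steps so slowly that up to LN the glued function is
nearly a single member of the family. -/

namespace StableSet

open Filter Topology

/-! ### Counting functions and sets of density zero -/

/-- The number of elements of `A` in `{1, …, N}`. -/
noncomputable def cnt (A : Set ℕ) (N : ℕ) : ℕ := (A ∩ Set.Icc 1 N).ncard

theorem finite_inter_Icc (A : Set ℕ) (N : ℕ) : (A ∩ Set.Icc 1 N).Finite :=
  (Set.finite_Icc 1 N).subset Set.inter_subset_right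

theorem cnt_mono {A B : Set ℕ} {N : ℕ} (h : ∀ n, 1 ≤ n → n ≤ N → n ∈ A → n ∈ B) :
    cnt A N ≤ cnt B N :=
  Set.ncard_le_ncard (fun _ hn => ⟨h _ hn.2.1 hn.2.2 hn.1, hn.2⟩) (finite_inter_Icc B N)

theorem cnt_union_le (A B : Set ℕ) (N : ℕ) : cnt (A ∪ B) N ≤ cnt A N + cnt B N := by
  unfold cnt
  rw [Set.union_inter_distrib_right]
  exact Set.ncard_union_le _ _

theorem cnt_le_cnt_right (A : Set ℕ) {M N : ℕ} (h : M ≤ N) : cnt A M ≤ cnt A N :=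
  Set.ncard_le_ncard (fun _ hn => ⟨hn.1, hn.2.1, hn.2.2.trans h⟩) (finite_inter_Icc A N)

theorem cnt_univ (N : ℕ) : cnt Set.univ N = N := by
  simp [cnt, Set.ncard_eq_toFinset_card']

theorem cnt_union_of_disjoint {A B : Set ℕ} (h : Disjoint A B) (N : ℕ) :
    cnt (A ∪ B) N = cnt A N + cnt B N := by
  unfold cnt
  rw [Set.union_inter_distrib_right]
  exact Set.ncard_union_eq (h.mono Set.inter_subset_left Set.inter_subset_left)
    (finite_inter_Icc A N) (finite_inter_Icc B N)

theorem cnt_preimage_le {f : ℕ → ℕ} (hf : Function.Injective f) (A : Set ℕ) {M N : ℕ}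
    (h1 : ∀ n, 1 ≤ n → 1 ≤ f n) (h2 : ∀ n, n ≤ N → f n ≤ M) :
    cnt {n | f n ∈ A} N ≤ cnt A M := by
  unfold cnt
  rw [← Set.ncard_image_of_injective _ hf]
  refine Set.ncard_le_ncard ?_ (finite_inter_Icc A M)
  rintro _ ⟨n, ⟨hn, hn1, hn2⟩, rfl⟩
  exact ⟨hn, h1 n hn1, h2 n hn2⟩

theorem cnt_mul_le {p : ℕ} (hp : 0 < p) (A : Set ℕ) (N : ℕ) :
    cnt {n | p * n ∈ A} N ≤ cnt A (p * N) :=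
  cnt_preimage_le (f := fun n => p * n) (fun _ _ h => Nat.eq_of_mul_eq_mul_left hp h) A
    (fun _ hn => Nat.mul_pos hp hn) (fun _ hn => Nat.mul_le_mul_left p hn)

theorem cnt_add_le (j : ℕ) (A : Set ℕ) (N : ℕ) :
    cnt {n | n + j ∈ A} N ≤ cnt A (N + j) :=
  cnt_preimage_le (f := fun n => n + j) (fun a b h => Nat.add_right_cancel h) A
    (fun n hn => by omega) (fun n hn => by omega)

theorem cnt_lt (K N : ℕ) : cnt {n | n < K} N ≤ K := by
  refine (Set.ncard_le_ncard (t := (↑(Finset.range K) : Set ℕ)) ?_ (Finset.finite_toSet _)).trans ?_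
  · intro n hn
    simpa using hn.1
  · rw [Set.ncard_coe_finset, Finset.card_range]

theorem cnt_le_cnt_succ_shift (A : Set ℕ) (N : ℕ) :
    cnt A N ≤ cnt {n | n + 1 ∈ A} N + 1 := by
  unfold cnt
  have : A ∩ Set.Icc 1 N ⊆ insert 1 ((fun n => n + 1) '' ({n | n + 1 ∈ A} ∩ Set.Icc 1 N)) := by
    rintro n ⟨hn, h1, h2⟩
    rcases Nat.eq_or_lt_of_le h1 with h | h
    · exact Or.inl h.symm
    · refine Or.inr ⟨n - 1, ⟨?_, by omega, by omega⟩, by simp; omega⟩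
      simpa [Nat.sub_add_cancel h1] using hn
  refine (Set.ncard_le_ncard this (((finite_inter_Icc _ N).image _).insert _)).trans ?_
  refine (Set.ncard_insert_le _ _).trans ?_
  rw [Set.ncard_image_of_injective _ (fun a b h => Nat.add_right_cancel h)]

theorem cnt_succ_le (A : Set ℕ) (N : ℕ) : cnt A (N + 1) ≤ cnt A N + 1 := by
  unfold cnt
  have : A ∩ Set.Icc 1 (N + 1) ⊆ insert (N + 1) (A ∩ Set.Icc 1 N) := by
    rintro n ⟨hn, h1, h2⟩
    rcases Nat.eq_or_lt_of_le h2 with h | h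
    · exact Or.inl h
    · exact Or.inr ⟨hn, h1, by omega⟩
  exact (Set.ncard_le_ncard this ((finite_inter_Icc _ N).insert _)).trans (Set.ncard_insert_le _ _)

theorem hasDensity_iff {A : Set ℕ} {δ : ℝ} :
    HasDensity A δ ↔ Tendsto (fun N : ℕ => (cnt A N : ℝ) / N) atTop (𝓝 δ) := Iff.rfl

/-- A set of density zero. -/
abbrev Null (A : Set ℕ) : Prop := HasDensity A 0

theorem null_iff {A : Set ℕ} :
    Null A ↔ ∀ ε : ℝ, 0 < ε → ∀ᶠ N : ℕ in atTop, (cnt A N : ℝ) ≤ ε * N := by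
  rw [Null, hasDensity_iff]
  constructor
  · intro h ε hε
    filter_upwards [h.eventually_lt_const hε, eventually_gt_atTop 0] with N hN hN0
    have : (0 : ℝ) < N := by exact_mod_cast hN0
    exact ((div_lt_iff₀ this).1 hN).le
  · intro h
    refine (Metric.tendsto_nhds).2 fun ε hε => ?_
    filter_upwards [h (ε / 2) (by positivity), eventually_gt_atTop 0] with N hN hN0
    have h0 : (0 : ℝ) < N := by exact_mod_cast hN0
    rw [Real.dist_eq, sub_zero, abs_of_nonneg (by positivity), div_lt_iff₀ h0]
    nlinarith

theorem Null.mono {A B : Set ℕ} (hB : Null B) (h : A ⊆ B) : Null A :=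
  null_iff.2 fun ε hε => (null_iff.1 hB ε hε).mono fun N hN =>
    le_trans (by exact_mod_cast cnt_mono fun n _ _ hn => h hn) hN

theorem Null.union {A B : Set ℕ} (hA : Null A) (hB : Null B) : Null (A ∪ B) := by
  refine null_iff.2 fun ε hε => ?_
  filter_upwards [null_iff.1 hA (ε / 2) (by positivity), null_iff.1 hB (ε / 2) (by positivity)]
    with N h1 h2
  have : (cnt (A ∪ B) N : ℝ) ≤ cnt A N + cnt B N := by exact_mod_cast cnt_union_le A B N
  linarith

theorem null_empty : Null ∅ := null_iff.2 fun ε hε => Eventually.of_forall fun N => by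
  simp only [cnt, Set.empty_inter, Set.ncard_empty, Nat.cast_zero]; positivity

theorem null_lt (K : ℕ) : Null {n | n < K} := by
  refine null_iff.2 fun ε hε => ?_
  filter_upwards [(tendsto_natCast_atTop_atTop (R := ℝ)).eventually_ge_atTop (K / ε)] with N hN
  have : (cnt {n | n < K} N : ℝ) ≤ K := by exact_mod_cast cnt_lt K N
  rw [div_le_iff₀ hε] at hN
  linarith

theorem null_biUnion_range {A : ℕ → Set ℕ} (h : ∀ j, Null (A j)) (k : ℕ) :
    Null {n | ∃ j < k, n ∈ A j} := by
  induction k with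
  | zero => exact null_empty.mono (by rintro n ⟨j, hj, _⟩; omega)
  | succ k ih =>
    refine (ih.union (h k)).mono ?_
    rintro n ⟨j, hj, hn⟩
    rcases Nat.lt_succ_iff_lt_or_eq.1 hj with h | rfl
    · exact Or.inl ⟨j, h, hn⟩
    · exact Or.inr hn

theorem Null.mul_preimage {A : Set ℕ} (hA : Null A) {p : ℕ} (hp : 0 < p) :
    Null {n | p * n ∈ A} := by
  refine null_iff.2 fun ε hε => ?_
  have hp' : (0 : ℝ) < p := by exact_mod_cast hp
  have ht : Tendsto (fun N : ℕ => p * N) atTop atTop := tendsto_id.const_mul_atTop' hp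
  filter_upwards [ht.eventually (null_iff.1 hA (ε / p) (by positivity))] with N h1
  have : (cnt {n | p * n ∈ A} N : ℝ) ≤ cnt A (p * N) := by exact_mod_cast cnt_mul_le hp A N
  refine this.trans (h1.trans_eq ?_)
  push_cast
  field_simp

theorem Null.add_preimage {A : Set ℕ} (hA : Null A) (j : ℕ) : Null {n | n + j ∈ A} := by
  refine null_iff.2 fun ε hε => ?_
  filter_upwards [(tendsto_add_atTop_nat j).eventually (null_iff.1 hA (ε / 2) (by positivity)),
    eventually_ge_atTop j] with N h1 h2
  have h3 : (cnt {n | n + j ∈ A} N : ℝ) ≤ cnt A (N + j) := by exact_mod_cast cnt_add_le j A N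
  have h4 : (j : ℝ) ≤ N := by exact_mod_cast h2
  push_cast at h1
  nlinarith

theorem tendsto_cnt_sub_of_null {A B : Set ℕ} (h : Null {n | ¬ (n ∈ A ↔ n ∈ B)}) :
    Tendsto (fun N : ℕ => (cnt A N : ℝ) / N - (cnt B N : ℝ) / N) atTop (𝓝 0) := by
  refine squeeze_zero_norm (fun N => ?_) (hasDensity_iff.1 h)
  rw [← sub_div, norm_div, Real.norm_natCast]
  gcongr
  rw [Real.norm_eq_abs, abs_sub_le_iff]
  have h1 : cnt A N ≤ cnt B N + cnt {n | ¬ (n ∈ A ↔ n ∈ B)} N := by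
    refine (cnt_mono ?_).trans (cnt_union_le _ _ _)
    intro n _ _ hn
    by_cases hB : n ∈ B
    · exact Or.inl hB
    · exact Or.inr (by simp [hn, hB])
  have h2 : cnt B N ≤ cnt A N + cnt {n | ¬ (n ∈ A ↔ n ∈ B)} N := by
    refine (cnt_mono ?_).trans (cnt_union_le _ _ _)
    intro n _ _ hn
    by_cases hA : n ∈ A
    · exact Or.inl hA
    · exact Or.inr (by simp [hn, hA])
  constructor
  · rw [sub_le_iff_le_add']; exact_mod_cast h1
  · rw [sub_le_iff_le_add']; exact_mod_cast h2

theorem HasDensity.congr {A B : Set ℕ} {δ : ℝ} (hB : HasDensity B δ)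
    (h : Null {n | ¬ (n ∈ A ↔ n ∈ B)}) : HasDensity A δ := by
  rw [hasDensity_iff] at *
  simpa using (tendsto_cnt_sub_of_null h).add hB

theorem HasDensity.compl {A : Set ℕ} {δ : ℝ} (h : HasDensity A δ) : HasDensity Aᶜ (1 - δ) := by
  rw [hasDensity_iff] at *
  refine (tendsto_const_nhds.sub h).congr' ?_
  filter_upwards [eventually_gt_atTop 0] with N hN
  have h1 := cnt_union_of_disjoint (disjoint_compl_right (a := A)) N
  rw [Set.union_compl_self, cnt_univ] at h1
  have h2 : (N : ℝ) = cnt A N + cnt Aᶜ N := by exact_mod_cast h1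
  have h0 : (N : ℝ) ≠ 0 := by positivity
  field_simp
  linarith

theorem HasDensity.union {A B : Set ℕ} {α β : ℝ} (hA : HasDensity A α) (hB : HasDensity B β)
    (h : Disjoint A B) : HasDensity (A ∪ B) (α + β) := by
  rw [hasDensity_iff] at *
  refine (hA.add hB).congr fun N => ?_
  rw [cnt_union_of_disjoint h, ← add_div]
  push_cast
  rfl

/-! ### Equidistribution in residue classes -/

/-- If `r` is almost everywhere locally constant, then `n ≡ r n` modulo `M` on a set of
density `1 / M`. -/
theorem hasDensity_eq_residue {M : ℕ} [NeZero M] {r : ℕ → ZMod M}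
    (hr : Null {n | r (n + 1) ≠ r n}) : HasDensity {n : ℕ | (n : ZMod M) = r n} (1 / M) := by
  let W : ZMod M → Set ℕ := fun v => {n | (n : ZMod M) = r n + v}
  let x : ZMod M → ℕ → ℝ := fun v N => (cnt (W v) N : ℝ) / N
  -- Adding 1 carries `W v` into `W (v + 1)` wherever `r` does not change. So the M classes, which
  -- partition ℕ, have asymptotically equal counts.
  have hstep : ∀ v, Tendsto (fun N => x (v + 1) N - x v N) atTop (𝓝 0) := by
    intro v
    have h1 : Tendsto (fun N : ℕ => (cnt {n | n + 1 ∈ W (v + 1)} N : ℝ) / N - x v N) atTop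
        (𝓝 0) := by
      refine tendsto_cnt_sub_of_null (hr.mono ?_)
      intro n hn heq
      apply hn
      simp only [W, Set.mem_ofPred_eq, heq, Nat.cast_add, Nat.cast_one, ← add_assoc,
        add_left_inj]
    have h2 : Tendsto (fun N : ℕ => x (v + 1) N - (cnt {n | n + 1 ∈ W (v + 1)} N : ℝ) / N) atTop
        (𝓝 0) := by
      refine squeeze_zero_norm (fun N => ?_) (tendsto_one_div_atTop_nhds_zero_nat (𝕜 := ℝ))
      rw [← sub_div, norm_div, Real.norm_natCast]
      gcongr
      rw [Real.norm_eq_abs, abs_sub_le_iff]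
      constructor
      · rw [sub_le_iff_le_add']
        exact_mod_cast cnt_le_cnt_succ_shift (W (v + 1)) N
      · rw [sub_le_iff_le_add']
        exact_mod_cast (cnt_add_le 1 (W (v + 1)) N).trans (cnt_succ_le _ N)
    simpa using h2.add h1
  have hall : ∀ k : ℕ, Tendsto (fun N => x (k : ZMod M) N - x 0 N) atTop (𝓝 0) := by
    intro k
    induction k with
    | zero => simp
    | succ k ih =>
      have := (hstep k).add ih
      simpa using this
  have hall' : ∀ v : ZMod M, Tendsto (fun N => x v N - x 0 N) atTop (𝓝 0) := by
    intro v
    simpa using hall v.val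
  have hsum : ∀ N, 0 < N → ∑ v : ZMod M, x v N = 1 := by
    intro N hN
    have hc : ∑ v : ZMod M, cnt (W v) N = N := by
      have h1 : ∀ v, cnt (W v) N = ((Finset.Icc 1 N).filter
          fun n : ℕ => (n : ZMod M) - r n = v).card := by
        intro v
        rw [← Set.ncard_coe_finset]
        unfold cnt
        congr 1
        ext n
        simp only [W, Set.mem_inter_iff, Set.mem_ofPred_eq, Set.mem_Icc, Finset.coe_filter,
          Finset.mem_Icc, sub_eq_iff_eq_add']
        tauto
      simp_rw [h1]
      rw [← Finset.card_eq_sum_card_fiberwise (fun _ _ => Finset.mem_coe.2 (Finset.mem_univ _))]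
      simp
    simp only [x]
    rw [← Finset.sum_div, ← Nat.cast_sum, hc, div_self (by positivity)]
  have hM : (0 : ℝ) < M := by exact_mod_cast NeZero.pos M
  have hlim : Tendsto (fun N => (1 - ∑ v : ZMod M, (x v N - x 0 N)) / M) atTop
      (𝓝 ((1 - ∑ _v : ZMod M, (0 : ℝ)) / M)) :=
    (tendsto_const_nhds.sub (tendsto_finsetSum _ fun v _ => hall' v)).div_const _
  rw [Finset.sum_const_zero, sub_zero] at hlim
  have hW0 : {n : ℕ | (n : ZMod M) = r n} = W 0 := by simp [W]
  rw [hW0, hasDensity_iff]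
  refine hlim.congr' ?_
  filter_upwards [eventually_gt_atTop 0] with N hN
  rw [Finset.sum_sub_distrib, hsum N hN]
  simp only [Finset.sum_const, Finset.card_univ, ZMod.card, nsmul_eq_mul, sub_sub_cancel]
  exact mul_div_cancel_left₀ _ hM.ne'

theorem cnt_multiples_le (M N : ℕ) :
    (cnt {n | M ∣ n} N : ℝ) ≤ N / M := by
  have h : cnt {n | M ∣ n} N = N / M := by
    rw [← Nat.Ioc_filter_dvd_card_eq_div, ← Set.ncard_coe_finset]
    unfold cnt
    congr 1
    ext n
    simp [Nat.succ_le_iff]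
    tauto
  rw [h]
  exact Nat.cast_div_le

/-! ### Last nonzero digits and the stable set -/

section LastDigit

variable (q : ℕ)

/-- The last nonzero digit of `n` in base `q`. -/
def lastDigit (n : ℕ) : ZMod q := (ordCompl[q] n : ℕ)

variable {q} [Fact q.Prime]

theorem lastDigit_mul (m n : ℕ) : lastDigit q (m * n) = lastDigit q m * lastDigit q n := by
  simp [lastDigit, Nat.ordCompl_mul]

theorem lastDigit_ne_zero {n : ℕ} (hn : n ≠ 0) : lastDigit q n ≠ 0 := by
  rw [lastDigit, Ne, ZMod.natCast_eq_zero_iff]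
  exact Nat.not_dvd_ordCompl Fact.out hn

theorem lastDigit_pow_mul {a m : ℕ} (hm : ¬ q ∣ m) : lastDigit q (q ^ a * m) = m := by
  have hq : q.Prime := Fact.out
  have hm0 : m ≠ 0 := by rintro rfl; exact hm (dvd_zero _)
  have h : (q ^ a * m).factorization q = a := by
    rw [Nat.factorization_mul (pow_ne_zero _ hq.ne_zero) hm0]
    simp [hq.factorization_pow, Nat.factorization_eq_zero_of_not_dvd hm]
  rw [lastDigit, h, Nat.mul_div_cancel_left _ (pow_pos hq.pos a)]

theorem lastDigit_of_not_dvd {n : ℕ} (hn : ¬ q ∣ n) : lastDigit q n = n := by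
  simpa using lastDigit_pow_mul (q := q) (a := 0) hn

theorem natCast_eq_pow_mul_iff {w n a : ℕ} (hw : ¬ q ∣ w) :
    (n : ZMod (q ^ (a + 1))) = ((q ^ a * w : ℕ) : ZMod (q ^ (a + 1))) ↔
      ∃ m, ¬ q ∣ m ∧ n = q ^ a * m ∧ (m : ZMod q) = w := by
  have hq : q.Prime := Fact.out
  have hqa : 0 < q ^ a := pow_pos hq.pos a
  rw [ZMod.natCast_eq_natCast_iff]
  constructor
  · intro h
    have hd : q ^ a ∣ n := by
      have h1 : n ≡ q ^ a * w [MOD q ^ a] := h.of_dvd (pow_dvd_pow q (Nat.le_succ a))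
      exact (h1.dvd_iff dvd_rfl).2 (dvd_mul_right _ _)
    obtain ⟨m, rfl⟩ := hd
    rw [pow_succ] at h
    have h2 : m ≡ w [MOD q] := Nat.ModEq.mul_left_cancel' hqa.ne' h
    exact ⟨m, fun hm => hw ((h2.dvd_iff dvd_rfl).1 hm), rfl, (ZMod.natCast_eq_natCast_iff _ _ _).2 h2⟩
  · rintro ⟨m, -, rfl, h⟩
    rw [ZMod.natCast_eq_natCast_iff] at h
    rw [pow_succ]
    exact h.mul_left' _

/-- Split by the exact power q^a dividing n: each part is a congruence modulo q^(a+1), of density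
q^-(a+1) by `hasDensity_eq_residue`. These sum to 1/(q-1), and what is omitted by stopping at a < k
consists of multiples of q^k. -/
theorem hasDensity_lastDigit {h : ℕ → (ZMod q)ˣ} (hh : Null {n | h (n + 1) ≠ h n}) :
    HasDensity {n | n ≠ 0 ∧ lastDigit q n = h n} (1 / ((q : ℝ) - 1)) := by
  have hq : q.Prime := Fact.out
  have hq1 : (1 : ℝ) < q := by exact_mod_cast hq.one_lt
  set T := {n | n ≠ 0 ∧ lastDigit q n = h n} with hT
  let w : ℕ → ℕ := fun n => (h n : ZMod q).val
  have hwcast : ∀ n, (w n : ZMod q) = h n := fun n => ZMod.natCast_zmod_val _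
  have hw : ∀ n, ¬ q ∣ w n := fun n hd => (h n).ne_zero <| by
    rw [← hwcast, ZMod.natCast_eq_zero_iff]; exact hd
  let U : ℕ → Set ℕ := fun a =>
    {n | (n : ZMod (q ^ (a + 1))) = ((q ^ a * w n : ℕ) : ZMod (q ^ (a + 1)))}
  have hUmem : ∀ a n, n ∈ U a ↔ ∃ m, ¬ q ∣ m ∧ n = q ^ a * m ∧ (m : ZMod q) = h n := by
    intro a n
    rw [← hwcast]
    exact natCast_eq_pow_mul_iff (hw n)
  have hUT : ∀ a n, n ∈ U a → n ∈ T := by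
    intro a n hn
    obtain ⟨m, hm, hnm, h1⟩ := (hUmem a n).1 hn
    refine ⟨?_, ?_⟩
    · rw [hnm]
      exact mul_ne_zero (pow_ne_zero _ hq.ne_zero) (by rintro rfl; exact hm (dvd_zero _))
    · rw [← h1, hnm, lastDigit_pow_mul hm]
  have hUdens : ∀ a, HasDensity (U a) (1 / (q ^ (a + 1) : ℕ)) := by
    intro a
    have : NeZero (q ^ (a + 1)) := ⟨pow_ne_zero _ hq.ne_zero⟩
    refine hasDensity_eq_residue (r := fun n => ((q ^ a * w n : ℕ) : ZMod (q ^ (a + 1)))) ?_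
    refine hh.mono fun n hn heq => hn ?_
    simp only [w, heq]
  have hdisj : ∀ a b, a < b → ∀ n, n ∈ U a → n ∉ U b := by
    intro a b hab n ha hb
    obtain ⟨m, hm, hnm, -⟩ := (hUmem a n).1 ha
    obtain ⟨m', -, hnm', -⟩ := (hUmem b n).1 hb
    obtain ⟨c, rfl⟩ := Nat.exists_eq_add_of_lt hab
    rw [hnm] at hnm'
    apply hm
    have : q ^ a * m = q ^ a * (q * (q ^ c * m')) := by rw [hnm']; ring
    rw [Nat.eq_of_mul_eq_mul_left (pow_pos hq.pos a) this]
    exact dvd_mul_right _ _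
  let V : ℕ → Set ℕ := fun k => {n | ∃ a < k, n ∈ U a}
  have hV : ∀ k, HasDensity (V k) ((1 - 1 / (q : ℝ) ^ k) / (q - 1)) := by
    intro k
    induction k with
    | zero =>
      have : V 0 = ∅ := by ext n; simp [V]
      simpa [this] using null_empty
    | succ k ih =>
      have hVs : V (k + 1) = V k ∪ U k := by
        ext n
        simp only [V, Set.mem_union, Set.mem_ofPred_eq, Nat.lt_succ_iff_lt_or_eq]
        constructor
        · rintro ⟨a, ha | rfl, hn⟩
          · exact Or.inl ⟨a, ha, hn⟩
          · exact Or.inr hn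
        · rintro (⟨a, ha, hn⟩ | hn)
          · exact ⟨a, Or.inl ha, hn⟩
          · exact ⟨k, Or.inr rfl, hn⟩
      rw [hVs]
      have hd : Disjoint (V k) (U k) := by
        rw [Set.disjoint_left]
        rintro n ⟨a, ha, hn⟩
        exact hdisj a k ha n hn
      convert ih.union (hUdens k) hd using 1
      have : (q : ℝ) - 1 ≠ 0 := by linarith
      push_cast
      field_simp
      ring
  have hTV : ∀ k N, (cnt T N : ℝ) ≤ cnt (V k) N + N / (q ^ k : ℕ) := by
    intro k N
    have h1 : cnt T N ≤ cnt (V k) N + cnt {n | q ^ k ∣ n} N := by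
      refine (cnt_mono ?_).trans (cnt_union_le _ _ _)
      rintro n - - ⟨hn0, hn⟩
      obtain ⟨a, m, hm, hnm⟩ := Nat.exists_eq_pow_mul_and_not_dvd hn0 q hq.ne_one
      by_cases hak : a < k
      · refine Or.inl ⟨a, hak, (hUmem a n).2 ⟨m, hm, hnm, ?_⟩⟩
        rw [← hn, hnm, lastDigit_pow_mul hm]
      · refine Or.inr ?_
        rw [Set.mem_ofPred_eq, hnm]
        exact (pow_dvd_pow q (not_lt.1 hak)).mul_right m
    have h2 := cnt_multiples_le (q ^ k) N
    have h3 : (cnt T N : ℝ) ≤ cnt (V k) N + cnt {n | q ^ k ∣ n} N := by exact_mod_cast h1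
    linarith
  have hVT : ∀ k N, (cnt (V k) N : ℝ) ≤ cnt T N := by
    intro k N
    exact_mod_cast cnt_mono (by rintro n - - ⟨a, -, hn⟩; exact hUT a n hn)
  rw [hasDensity_iff, Metric.tendsto_nhds]
  intro ε hε
  have hpow : Tendsto (fun k : ℕ => 1 / (q : ℝ) ^ k) atTop (𝓝 0) := by
    have h0 := tendsto_pow_atTop_nhds_zero_of_lt_one (r := ((q : ℝ))⁻¹) (by positivity)
      (inv_lt_one_of_one_lt₀ hq1)
    simpa using h0
  obtain ⟨k, hk⟩ := (hpow.eventually_lt_const (by positivity : (0 : ℝ) < ε / 2)).exists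
  have hqs : (1 : ℝ) ≤ q - 1 := by
    have : (2 : ℝ) ≤ q := by exact_mod_cast hq.two_le
    linarith
  have hk0 : 0 < 1 / (q : ℝ) ^ k := by positivity
  have hlim : |(1 - 1 / (q : ℝ) ^ k) / (q - 1) - 1 / (q - 1)| ≤ 1 / (q : ℝ) ^ k := by
    rw [← sub_div, sub_sub_cancel_left, abs_div, abs_neg, abs_of_pos hk0, abs_of_pos (by linarith)]
    exact div_le_self hk0.le hqs
  have hVk := hV k
  rw [hasDensity_iff, Metric.tendsto_nhds] at hVk
  filter_upwards [hVk (ε / 2) (by positivity), eventually_gt_atTop 0,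
    (hV k).eventually_lt_const (u := (1 - 1 / (q : ℝ) ^ k) / (q - 1) + (ε / 2 - 1 / (q : ℝ) ^ k))
      (by linarith)] with N h1 hN h2
  have hN0 : (0 : ℝ) < N := by exact_mod_cast hN
  have h3 : (cnt T N : ℝ) / N ≤ (cnt (V k) N : ℝ) / N + 1 / (q : ℝ) ^ k := by
    have := hTV k N
    rw [div_add' _ _ _ hN0.ne', div_le_div_iff_of_pos_right hN0]
    push_cast at this
    calc _ ≤ _ := this
      _ = _ := by ring
  have h4 : (cnt (V k) N : ℝ) / N ≤ (cnt T N : ℝ) / N := by gcongr; exact_mod_cast hVT k N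
  have h2' : (cnt (V k) N : ℝ) / N <
    (1 - 1 / (q : ℝ) ^ k) / (q - 1) + (ε / 2 - 1 / (q : ℝ) ^ k) := h2
  rw [Real.dist_eq, abs_sub_lt_iff] at h1 ⊢
  rw [abs_sub_le_iff] at hlim
  constructor <;> linarith

/-- A function that is almost everywhere locally constant and almost everywhere twisted by `lastDigit`
under multiplication by primes yields a stable set that misses a term of each block of length `q`. -/
theorem exists_stable_of_twisted {X h : ℕ → (ZMod q)ˣ}
    (hX : ∀ n, n ≠ 0 → (X n : ZMod q) = lastDigit q n)
    (hmul : ∀ p, p.Prime → Null {n | h (p * n) ≠ X p * h n})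
    (hadd : Null {n | h (n + 1) ≠ h n}) :
    ∃ S : Set ℕ, IsStable S ∧ HasDensity S (1 - 1 / ((q : ℝ) - 1)) ∧ consecutiveInter S q = ∅ := by
  have hq : q.Prime := Fact.out
  set T := {n | n ≠ 0 ∧ lastDigit q n = h n} with hT
  have hloc : ∀ k, Null {n | ∃ j < k, h (n + j) ≠ h n} := by
    intro k
    refine (null_biUnion_range (fun j => hadd.add_preimage j) k).mono ?_
    rintro n ⟨j, hj, hne⟩
    by_contra hcon
    simp only [Set.mem_ofPred_eq, not_exists, not_and, not_not] at hcon
    apply hne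
    clear hne
    induction j with
    | zero => rfl
    | succ j ih => rw [← add_assoc, hcon j (by omega), ih (by omega)]
  have hmem : ∀ n, n ∈ consecutiveInter Tᶜ q ↔ ∀ j < q, ∃ m, m ∉ T ∧ m + j = n := by
    intro n
    simp [consecutiveInter, translate]
  have hnull : Null (consecutiveInter Tᶜ q) := by
    have hshift : Null {n | n + (q - 1) ∈ consecutiveInter Tᶜ q} := by
      refine ((hloc q).union (null_lt 1)).mono ?_
      intro n hn
      by_contra hcon
      simp only [Set.mem_union, Set.mem_ofPred_eq, not_or, not_exists, not_and, not_not] at hcon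
      obtain ⟨h1, h2⟩ := hcon
      -- This is the place in the block where n + j ≡ h n mod q. As h n is a unit, n + j is prime to
      -- q, so its last nonzero digit is its own residue.
      let j : ℕ := ((h n : ZMod q) - n).val
      have hj : j < q := ZMod.val_lt _
      have hcast : ((n + j : ℕ) : ZMod q) = h n := by
        simp [j]
      obtain ⟨m, hm, hmj⟩ := (hmem _).1 hn (q - 1 - j) (by omega)
      have hmn : m = n + j := by omega
      subst hmn
      apply hm
      refine ⟨by omega, ?_⟩
      rw [lastDigit_of_not_dvd, hcast, h1 j hj]
      rw [← ZMod.natCast_eq_zero_iff, hcast]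
      exact (h n).ne_zero
    refine null_iff.2 fun ε hε => ?_
    have hA : ∀ k N, cnt (consecutiveInter Tᶜ q) N ≤
        cnt {n | n + k ∈ consecutiveInter Tᶜ q} N + k := by
      intro k N
      induction k with
      | zero => exact le_rfl
      | succ k ih =>
        have h1 := cnt_le_cnt_succ_shift {n | n + k ∈ consecutiveInter Tᶜ q} N
        simp only [Set.mem_ofPred_eq, add_right_comm] at h1
        simp only [← add_assoc]
        exact ih.trans (by omega)
    filter_upwards [null_iff.1 hshift (ε / 2) (by positivity),
      (tendsto_natCast_atTop_atTop (R := ℝ)).eventually_ge_atTop (q / (ε / 2))] with N h1 h2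
    rw [div_le_iff₀ (by positivity)] at h2
    have h3 : (cnt (consecutiveInter Tᶜ q) N : ℝ) ≤
        cnt {n | n + (q - 1) ∈ consecutiveInter Tᶜ q} N + q := by
      exact_mod_cast (hA (q - 1) N).trans (by omega)
    linarith
  -- Removing the null intersection affects neither density nor stability. A point of the new
  -- intersection would lie in the old one and also, through the translate by 0, in the set from
  -- which the old one was removed.
  refine ⟨Tᶜ \ consecutiveInter Tᶜ q, ?_, ?_, ?_⟩
  · intro p hp
    refine (((hmul p hp).union (null_lt 1)).union
      (hnull.union (hnull.mul_preimage hp.pos))).mono ?_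
    intro n hn
    by_contra hcon
    simp only [Set.mem_union, Set.mem_ofPred_eq, not_or, not_not, Nat.lt_one_iff] at hcon
    obtain ⟨⟨h1, h2⟩, h3, h4⟩ := hcon
    apply hn
    have hiff : n ∈ T ↔ p * n ∈ T := by
      simp only [hT, Set.mem_ofPred_eq, h1, lastDigit_mul, Units.val_mul, hX p hp.ne_zero]
      have hpn : p * n ≠ 0 := mul_ne_zero hp.ne_zero h2
      simp only [h2, hpn, ne_eq, not_false_eq_true, true_and]
      exact (mul_right_inj' (lastDigit_ne_zero hp.ne_zero)).symm
    simp only [Set.mem_sdiff, Set.mem_compl_iff, h3, h4, hiff]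
  · refine HasDensity.congr (hasDensity_lastDigit hadd).compl (hnull.mono ?_)
    intro n hn
    by_contra hcon
    exact hn ⟨fun h => h.1, fun h => ⟨h, hcon⟩⟩
  · rw [Set.eq_empty_iff_forall_notMem]
    intro n hn
    have hmono : n ∈ consecutiveInter Tᶜ q := by
      simp only [consecutiveInter, Set.mem_iInter] at hn ⊢
      exact fun j hj => Set.image_mono Set.sdiff_subset (hn j hj)
    have h0 : n ∈ translate (Tᶜ \ consecutiveInter Tᶜ q) 0 := by
      simp only [consecutiveInter, Set.mem_iInter] at hn
      exact hn 0 (Finset.mem_range.2 hq.pos)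
    obtain ⟨m, hm, hmn⟩ := h0
    have : m = n := hmn
    exact hm.2 (this ▸ hmono)

end LastDigit

/-! ### Mean values of exponentials on a half-line -/

/-- `F` has mean value `c` over the half-line `[a, ∞)`. -/
def HasMean (a : ℝ) (F : ℝ → ℂ) (c : ℂ) : Prop :=
  Continuous F ∧ Tendsto (fun T : ℝ => ((T : ℂ))⁻¹ * ∫ t in a..T, F t) atTop (𝓝 c)

theorem HasMean.sum {a : ℝ} {ι : Type*} (s : Finset ι) {F : ι → ℝ → ℂ} {c : ι → ℂ}
    (h : ∀ i ∈ s, HasMean a (F i) (c i)) :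
    HasMean a (fun t => ∑ i ∈ s, F i t) (∑ i ∈ s, c i) := by
  refine ⟨continuous_finsetSum _ fun i hi => (h i hi).1, ?_⟩
  refine (tendsto_finsetSum s fun i hi => (h i hi).2).congr fun T => ?_
  rw [intervalIntegral.integral_finsetSum fun i hi => (h i hi).1.intervalIntegrable _ _,
    Finset.mul_sum]

theorem HasMean.const_mul {a : ℝ} {F : ℝ → ℂ} {c : ℂ} (h : HasMean a F c) (b : ℂ) :
    HasMean a (fun t => b * F t) (b * c) := by
  refine ⟨continuous_const.mul h.1, ?_⟩
  refine (h.2.const_mul b).congr fun T => ?_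
  rw [intervalIntegral.integral_const_mul]
  ring

theorem HasMean.sub {a : ℝ} {F G : ℝ → ℂ} {c d : ℂ} (hF : HasMean a F c) (hG : HasMean a G d) :
    HasMean a (fun t => F t - G t) (c - d) := by
  refine ⟨hF.1.sub hG.1, ?_⟩
  refine (hF.2.sub hG.2).congr fun T => ?_
  rw [intervalIntegral.integral_sub (hF.1.intervalIntegrable _ _) (hG.1.intervalIntegrable _ _)]
  ring

theorem hasMean_one (a : ℝ) : HasMean a (fun _ => 1) 1 := by
  refine ⟨continuous_const, ?_⟩
  have h : Tendsto (fun T : ℝ => ((1 - T⁻¹ * a : ℝ) : ℂ)) atTop (𝓝 ((1 - 0 * a : ℝ) : ℂ)) :=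
    (Complex.continuous_ofReal.tendsto _).comp (tendsto_const_nhds.sub (tendsto_inv_atTop_zero.mul_const a))
  simp only [zero_mul, sub_zero, Complex.ofReal_one] at h
  refine h.congr' ?_
  filter_upwards [eventually_gt_atTop 0] with T hT
  have : (T : ℂ) ≠ 0 := by exact_mod_cast hT.ne'
  simp
  field_simp

theorem hasMean_exp (a : ℝ) {ω : ℝ} (hω : ω ≠ 0) :
    HasMean a (fun t => Complex.exp (ω * Complex.I * t)) 0 := by
  refine ⟨by fun_prop, ?_⟩
  have hω' : (ω : ℂ) * Complex.I ≠ 0 := by simp [hω]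
  have hlim : Tendsto (fun T : ℝ => T⁻¹ * (2 / |ω|)) atTop (𝓝 0) := by
    simpa using tendsto_inv_atTop_zero.mul_const (2 / |ω|)
  refine squeeze_zero_norm' ?_ hlim
  filter_upwards [eventually_gt_atTop 0] with T hT
  rw [integral_exp_mul_complex hω', norm_mul, norm_inv, Complex.norm_real, Real.norm_of_nonneg hT.le]
  gcongr
  rw [norm_div]
  simp only [norm_mul, Complex.norm_real, Complex.norm_I, mul_one, Real.norm_eq_abs]
  gcongr
  refine (norm_sub_le _ _).trans ?_
  have h1 : ∀ t : ℝ, ‖Complex.exp (ω * Complex.I * t)‖ = 1 := fun t => by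
    rw [show (ω : ℂ) * Complex.I * t = ((ω * t : ℝ) : ℂ) * Complex.I by push_cast; ring]
    exact Complex.norm_exp_ofReal_mul_I _
  rw [h1, h1]
  norm_num

theorem HasMean.re_nonneg {a : ℝ} {F : ℝ → ℂ} {c : ℂ} (h : HasMean a F c)
    (hF : ∀ t, a ≤ t → 0 ≤ (F t).re) : 0 ≤ c.re := by
  refine ge_of_tendsto ((Complex.continuous_re.tendsto _).comp h.2) ?_
  filter_upwards [eventually_ge_atTop a, eventually_ge_atTop 0] with T hT hT0
  have h1 : ((∫ t in a..T, F t).re) = ∫ t in a..T, (F t).re :=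
    (Complex.reCLM.intervalIntegral_comp_comm (h.1.intervalIntegrable _ _)).symm
  simp only [Function.comp]
  rw [← Complex.ofReal_inv, Complex.re_ofReal_mul, h1]
  refine mul_nonneg (by positivity) (intervalIntegral.integral_nonneg hT fun t ht => hF t ht.1)

/-! ### Kronecker's theorem for logarithms of primes -/

/-- If `n` is divisible by a high power of `p`, then few divisors of `n` cease to divide `n` when
multiplied by `p`. -/
theorem card_divisors_div_prime {p e n : ℕ} (hp : p.Prime) (hn : n ≠ 0) (h : p ^ e ∣ n) :
    (e + 1) * (n.divisors.filter fun s => ¬ p * s ∣ n).card ≤ n.divisors.card := by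
  classical
  set A := n.divisors.filter fun s => ¬ p * s ∣ n with hA
  have hfac : ∀ s ∈ A, s ≠ 0 ∧ s ∣ n ∧ s.factorization p = n.factorization p := by
    intro s hs
    simp only [hA, Finset.mem_filter, Nat.mem_divisors] at hs
    obtain ⟨⟨hsn, -⟩, hps⟩ := hs
    have hs0 : s ≠ 0 := ne_zero_of_dvd_ne_zero hn hsn
    refine ⟨hs0, hsn, ?_⟩
    by_contra hne
    apply hps
    have hle := (Nat.factorization_le_iff_dvd hs0 hn).2 hsn
    rw [← Nat.factorization_le_iff_dvd (mul_ne_zero hp.ne_zero hs0) hn,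
      Nat.factorization_mul hp.ne_zero hs0, hp.factorization]
    intro r
    have hr := hle r
    by_cases hrp : r = p
    · subst hrp
      simp only [Finsupp.add_apply, Finsupp.single_eq_same]
      omega
    · simpa [Finsupp.single_apply, Ne.symm hrp] using hr
  have he : e ≤ n.factorization p := (hp.pow_dvd_iff_le_factorization hn).1 h
  have hdvd : ∀ s ∈ A, ∀ j ≤ e, p ^ j ∣ s := fun s hs j hj =>
    (hp.pow_dvd_iff_le_factorization (hfac s hs).1).2 ((hfac s hs).2.2 ▸ hj.trans he)
  have hcard : (Finset.range (e + 1) ×ˢ A).card = (e + 1) * A.card := by simp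
  rw [← hcard]
  -- Every s in `A` carries the full power of p in n, so the p-adic valuation of s / p^j determines
  -- j, and then s.
  refine Finset.card_le_card_of_injOn (fun x => x.2 / p ^ x.1) ?_ ?_
  · rintro ⟨j, s⟩ hx
    simp only [Finset.coe_product, Set.mem_prod, Finset.mem_coe, Finset.mem_range] at hx
    have := hfac s hx.2
    exact Finset.mem_coe.2 (Nat.mem_divisors.2
      ⟨(Nat.div_dvd_of_dvd (hdvd s hx.2 j (by omega))).trans this.2.1, hn⟩)
  · rintro ⟨j, s⟩ hx ⟨j', s'⟩ hx' heq
    simp only [Finset.coe_product, Set.mem_prod, Finset.mem_coe, Finset.mem_range] at hx hx' heq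
    have h1 := hdvd s hx.2 j (by omega)
    have h2 := hdvd s' hx'.2 j' (by omega)
    have h3 := hfac s hx.2
    have h4 := hfac s' hx'.2
    have hf := congrArg (fun m => m.factorization p) heq
    simp only [Nat.factorization_div h1, Nat.factorization_div h2, Finsupp.tsub_apply,
      hp.factorization_pow, Finsupp.single_eq_same, h3.2.2, h4.2.2] at hf
    have hj : j = j' := by omega
    subst hj
    have : s = s' := by
      rw [← Nat.div_mul_cancel h1, ← Nat.div_mul_cancel h2, heq]
    rw [this]

section Kronecker

variable (X : ℕ → ℂ)

/-- The twist `conj (X n) * n ^ (i t)` of `n ↦ n ^ (i t)`. -/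
noncomputable def twist (t : ℝ) (n : ℕ) : ℂ :=
  star (X n) * Complex.exp (Real.log n * Complex.I * t)

variable {X}

theorem star_exp_mul_I (ω t : ℝ) :
    star (Complex.exp (ω * Complex.I * t)) = Complex.exp (-ω * Complex.I * t) := by
  rw [Complex.star_def, ← Complex.exp_conj]
  simp

theorem twist_mul (hmul : ∀ m n, 0 < m → 0 < n → X (m * n) = X m * X n) (t : ℝ) {m n : ℕ}
    (hm : 0 < m) (hn : 0 < n) : twist X t (m * n) = twist X t m * twist X t n := by
  have hm' : (m : ℝ) ≠ 0 := by positivity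
  have hn' : (n : ℝ) ≠ 0 := by positivity
  rw [twist, twist, twist, hmul m n hm hn, star_mul', Nat.cast_mul, Real.log_mul hm' hn']
  rw [show ((Real.log m + Real.log n : ℝ) : ℂ) * Complex.I * t =
    Real.log m * Complex.I * t + Real.log n * Complex.I * t by push_cast; ring, Complex.exp_add]
  ring

/-- Orthogonality: distinct positive integers have distinct logarithms, so for u ≠ v the product is
a nonconstant exponential. -/
theorem hasMean_twist (hnorm : ∀ n, 0 < n → ‖X n‖ = 1) (a : ℝ) {u v : ℕ} (hu : 0 < u)
    (hv : 0 < v) :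
    HasMean a (fun t => twist X t u * star (twist X t v)) (if u = v then 1 else 0) := by
  have key : ∀ t : ℝ, twist X t u * star (twist X t v) = (star (X u) * X v) *
      Complex.exp (((Real.log u - Real.log v : ℝ) : ℂ) * Complex.I * t) := by
    intro t
    rw [twist, twist, star_mul', star_star, star_exp_mul_I,
      show ((Real.log u - Real.log v : ℝ) : ℂ) * Complex.I * t =
        Real.log u * Complex.I * t + -Real.log v * Complex.I * t by push_cast; ring,
      Complex.exp_add]
    ring
  simp_rw [key]
  split_ifs with h
  · subst h
    have h1 : star (X u) * X u = 1 := by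
      rw [Complex.star_def, Complex.conj_mul', hnorm u hu]
      norm_num
    simp only [h1, one_mul, sub_self, Complex.ofReal_zero, zero_mul, Complex.exp_zero]
    exact hasMean_one a
  · have hω : Real.log u - Real.log v ≠ 0 := by
      intro h0
      apply h
      have := Real.log_injOn_pos (Set.mem_Ioi.2 (by exact_mod_cast hu : (0 : ℝ) < u))
        (Set.mem_Ioi.2 (by exact_mod_cast hv : (0 : ℝ) < v)) (sub_eq_zero.1 h0)
      exact_mod_cast this
    simpa using (hasMean_exp a hω).const_mul (star (X u) * X v)

/-- A form of Kronecker's theorem: a completely multiplicative function with values on the unit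
circle is approximated at finitely many primes by `n ↦ n ^ (i t)`, for some large `t`. -/
theorem exists_twist_near_one (hmul : ∀ m n, 0 < m → 0 < n → X (m * n) = X m * X n)
    (hnorm : ∀ n, 0 < n → ‖X n‖ = 1) (a : ℝ) (Q : Finset ℕ) (hQ : ∀ p ∈ Q, p.Prime) {η : ℝ}
    (hη : 0 < η) : ∃ t, a ≤ t ∧ ∑ p ∈ Q, (1 - (twist X t p).re) < η := by
  classical
  by_contra! hcon
  obtain ⟨L, hL⟩ := exists_nat_gt ((Q.card : ℝ) / η)
  set n := (∏ p ∈ Q, p) ^ L with hn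
  have hn0 : n ≠ 0 := pow_ne_zero _ (Finset.prod_ne_zero_iff.2 fun p hp => (hQ p hp).ne_zero)
  set B := n.divisors with hB
  have hpos : ∀ s ∈ B, 0 < s := fun s hs => Nat.pos_of_mem_divisors hs
  have hBcard : 0 < B.card := Finset.card_pos.2 ⟨1, Nat.one_mem_divisors.2 hn0⟩
  -- A Fejér kernel argument: multiply ∑ (1 - twist p) - η, whose real part is assumed nonnegative,
  -- by |∑_{s ∣ n} twist s|² and take means. By orthogonality the result is ∑_p #{s ∣ n : ps ∤ n} -
  -- η d(n). As n is an L-th power divisible by each p^L, this is at most (|Q|/(L+1) - η) d(n) < 0.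
  let c : ℕ → ℕ → ℂ := fun s s' =>
    ∑ p ∈ Q, ((if s = s' then 1 else 0) - if p * s = s' then 1 else 0) -
      (η : ℂ) * (if s = s' then 1 else 0)
  let G : ℕ → ℕ → ℝ → ℂ := fun s s' t =>
    ∑ p ∈ Q, (twist X t s * star (twist X t s') - twist X t (p * s) * star (twist X t s')) -
      (η : ℂ) * (twist X t s * star (twist X t s'))
  have hmean : HasMean a (fun t => ∑ s ∈ B, ∑ s' ∈ B, G s s' t) (∑ s ∈ B, ∑ s' ∈ B, c s s') := by
    refine HasMean.sum _ fun s hs => HasMean.sum _ fun s' hs' => ?_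
    refine HasMean.sub (HasMean.sum _ fun p hp => ?_)
      ((hasMean_twist hnorm a (hpos s hs) (hpos s' hs')).const_mul _)
    exact (hasMean_twist hnorm a (hpos s hs) (hpos s' hs')).sub
      (hasMean_twist hnorm a (Nat.mul_pos (hQ p hp).pos (hpos s hs)) (hpos s' hs'))
  have hGeq : ∀ t, ∑ s ∈ B, ∑ s' ∈ B, G s s' t =
      ((‖∑ s ∈ B, twist X t s‖ ^ 2 : ℝ) : ℂ) * (∑ p ∈ Q, (1 - twist X t p) - (η : ℂ)) := by
    intro t
    have h1 : ∀ s ∈ B, ∀ s' ∈ B, G s s' t =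
        (twist X t s * star (twist X t s')) * (∑ p ∈ Q, (1 - twist X t p) - (η : ℂ)) := by
      intro s hs s' hs'
      simp only [G]
      rw [mul_sub, Finset.mul_sum]
      congr 1
      · refine Finset.sum_congr rfl fun p hp => ?_
        rw [twist_mul hmul t (hQ p hp).pos (hpos s hs)]
        ring
      · ring
    rw [Finset.sum_congr rfl fun s hs => Finset.sum_congr rfl fun s' hs' => h1 s hs s' hs']
    simp_rw [← Finset.sum_mul, ← Finset.mul_sum, ← Finset.sum_mul]
    rw [← star_sum, Complex.star_def, Complex.mul_conj']
    push_cast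
    rfl
  have hnonneg := hmean.re_nonneg (fun t ht => by
    rw [hGeq, Complex.re_ofReal_mul]
    refine mul_nonneg (by positivity) ?_
    simpa using hcon t ht)
  have hc : ∑ s ∈ B, ∑ s' ∈ B, c s s' =
      ((∑ p ∈ Q, ((B.filter fun s => ¬ p * s ∣ n).card : ℝ) - η * B.card : ℝ) : ℂ) := by
    have h1 : ∀ s ∈ B, ∑ s' ∈ B, c s s' =
        ∑ p ∈ Q, (if ¬ p * s ∣ n then (1 : ℂ) else 0) - (η : ℂ) := by
      intro s hs
      simp only [c]
      rw [Finset.sum_sub_distrib, Finset.sum_comm, ← Finset.mul_sum]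
      simp only [Finset.sum_sub_distrib, Finset.sum_ite_eq, hs, if_true, mul_one]
      rw [← Finset.sum_sub_distrib]
      congr 1
      refine Finset.sum_congr rfl fun p _ => ?_
      by_cases h : p * s ∣ n
      · simp [hB, h, hn0]
      · simp [hB, h]
    rw [Finset.sum_congr rfl h1, Finset.sum_sub_distrib, Finset.sum_comm]
    simp only [Finset.sum_boole, Finset.sum_const, nsmul_eq_mul]
    push_cast
    ring
  rw [hc, Complex.ofReal_re] at hnonneg
  have hle : ∀ p ∈ Q, ((B.filter fun s => ¬ p * s ∣ n).card : ℝ) ≤ B.card / (L + 1) := by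
    intro p hp
    rw [le_div_iff₀ (by positivity)]
    have := card_divisors_div_prime (e := L) (hQ p hp) hn0
      (pow_dvd_pow_of_dvd (Finset.dvd_prod_of_mem _ hp) L)
    have h2 : ((L : ℝ) + 1) * ((B.filter fun s => ¬ p * s ∣ n).card : ℝ) ≤ B.card := by
      exact_mod_cast this
    linarith
  have hsum := Finset.sum_le_sum hle
  rw [Finset.sum_const, nsmul_eq_mul] at hsum
  rw [div_lt_iff₀ hη] at hL
  have hB' : (0 : ℝ) < B.card := by exact_mod_cast hBcard
  have h3 : (Q.card : ℝ) * (B.card / (L + 1)) < η * B.card := by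
    rw [← mul_div_assoc, div_lt_iff₀ (by positivity)]
    nlinarith
  linarith

end Kronecker

theorem exists_int_near_of_cos {ε : ℝ} (hε : 0 < ε) :
    ∃ η > 0, ∀ x : ℝ, 1 - Real.cos (2 * Real.pi * x) < η → ∃ l : ℤ, |x - l| < ε := by
  -- The 8 comes from cos y ≤ 1 - 2y²/π² on |y| ≤ π, with y = 2π(x - round x).
  refine ⟨8 * ε ^ 2, by positivity, fun x hx => ⟨round x, ?_⟩⟩
  have h1 := abs_sub_round x
  have hpi := Real.pi_pos
  have hcos : Real.cos (2 * Real.pi * x) = Real.cos (2 * Real.pi * (x - round x)) := by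
    rw [show 2 * Real.pi * (x - round x) = 2 * Real.pi * x - (round x : ℤ) * (2 * Real.pi) by ring,
      Real.cos_sub_int_mul_two_pi]
  have h2 : |2 * Real.pi * (x - round x)| ≤ Real.pi := by
    rw [abs_mul, abs_of_pos (by positivity)]
    nlinarith
  have h3 := Real.cos_le_one_sub_mul_cos_sq h2
  rw [hcos] at hx
  have h4 : 2 / Real.pi ^ 2 * (2 * Real.pi * (x - round x)) ^ 2 = 8 * (x - round x) ^ 2 := by
    field_simp; ring
  rw [h4] at h3
  exact abs_lt_of_sq_lt_sq (by linarith) hε.le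

/-- Kronecker's theorem is applied to the character exp(2πi e(X n)/d), with d the order of γ and t =
2πc/d. Exponents count only modulo d, so (c log p - e)/d has to be within ε/d of an integer. Taking
t ≥ 2π ensures c ≥ 1. -/
theorem exists_scale {G : Type*} [CommGroup G] [Finite G] {γ : G} (hγ : ∀ x, x ∈ Subgroup.zpowers γ)
    {X : ℕ → G} (hX : ∀ m n, 0 < m → 0 < n → X (m * n) = X m * X n) (Q : Finset ℕ)
    (hQ : ∀ p ∈ Q, p.Prime) {ε : ℝ} (hε : 0 < ε) :
    ∃ c : ℝ, 1 ≤ c ∧ ∀ p ∈ Q, ∃ m : ℤ, γ ^ m = X p ∧ |c * Real.log p - m| < ε := by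
  choose e he using hγ
  have he : ∀ x, γ ^ e x = x := he
  set d := orderOf γ with hd
  have hd0 : 0 < d := orderOf_pos γ
  have hdR : (0 : ℝ) < d := by exact_mod_cast hd0
  have hdC : (d : ℂ) ≠ 0 := by exact_mod_cast hd0.ne'
  let E : ℕ → ℂ := fun n => Complex.exp (((2 * Real.pi * (e (X n) / d) : ℝ) : ℂ) * Complex.I)
  have hnorm : ∀ n, 0 < n → ‖E n‖ = 1 := fun n _ => Complex.norm_exp_ofReal_mul_I _
  have hmul : ∀ m n, 0 < m → 0 < n → E (m * n) = E m * E n := by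
    intro m n hm hn
    have h1 : γ ^ (e (X m) + e (X n)) = γ ^ e (X (m * n)) := by
      rw [zpow_add, he, he, he, hX m n hm hn]
    rw [zpow_eq_zpow_iff_modEq] at h1
    obtain ⟨k, hk⟩ := h1.dvd
    simp only [E]
    rw [← Complex.exp_add, Complex.exp_eq_exp_iff_exists_int]
    refine ⟨k, ?_⟩
    have hk' : ((e (X (m * n)) : ℤ) : ℂ) = e (X m) + e (X n) + d * k := by
      have : e (X (m * n)) = e (X m) + e (X n) + d * k := by rw [hd]; linarith
      rw [this]; push_cast; ring
    push_cast
    rw [hk']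
    field_simp
  have hcos : ∀ t p, (twist E t p).re =
      Real.cos (2 * Real.pi * ((t * d / (2 * Real.pi) * Real.log p - e (X p)) / d)) := by
    intro t p
    have : twist E t p = Complex.exp (((2 * Real.pi *
        ((t * d / (2 * Real.pi) * Real.log p - e (X p)) / d) : ℝ) : ℂ) * Complex.I) := by
      have hst : star (E p) =
          Complex.exp (((-(2 * Real.pi * (e (X p) / d)) : ℝ) : ℂ) * Complex.I) := by
        simp only [E]
        rw [Complex.star_def, ← Complex.exp_conj, map_mul, Complex.conj_ofReal, Complex.conj_I]
        congr 1
        push_cast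
        ring
      rw [twist, hst, ← Complex.exp_add]
      congr 1
      have hpi : (Real.pi : ℂ) ≠ 0 := by exact_mod_cast Real.pi_pos.ne'
      push_cast
      field_simp
      ring
    rw [this, Complex.exp_ofReal_mul_I_re]
  obtain ⟨η, hη, hround⟩ := exists_int_near_of_cos (div_pos hε hdR)
  obtain ⟨t, ht, hlt⟩ := exists_twist_near_one hmul hnorm (2 * Real.pi) Q hQ hη
  refine ⟨t * d / (2 * Real.pi), ?_, fun p hp => ?_⟩
  · rw [le_div_iff₀ (by positivity), one_mul]
    have : (1 : ℝ) ≤ d := by exact_mod_cast hd0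
    nlinarith [Real.pi_pos]
  · have h1 : 1 - (twist E t p).re < η := by
      refine lt_of_le_of_lt (Finset.single_le_sum (f := fun p => 1 - (twist E t p).re) ?_ hp) hlt
      intro p' _
      simp only [hcos, sub_nonneg]
      exact Real.cos_le_one _
    rw [hcos] at h1
    obtain ⟨l, hl⟩ := hround _ h1
    refine ⟨e (X p) + d * l, ?_, ?_⟩
    · rw [zpow_add, zpow_mul, zpow_natCast, hd, pow_orderOf_eq_one, one_zpow, mul_one, he]
    · have h2 : t * d / (2 * Real.pi) * Real.log p - ((e (X p) + d * l : ℤ) : ℝ) =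
          d * ((t * d / (2 * Real.pi) * Real.log p - e (X p)) / d - l) := by
        push_cast
        field_simp
        ring
      rw [h2, abs_mul, abs_of_pos hdR]
      rw [lt_div_iff₀ hdR] at hl
      linarith

/-! ### Distribution of c log n modulo 1 -/

theorem cnt_biUnion_le (A : ℕ → Set ℕ) (M N : ℕ) :
    cnt {n | ∃ m < M, n ∈ A m} N ≤ ∑ m ∈ Finset.range M, cnt (A m) N := by
  induction M with
  | zero => simp [cnt]
  | succ M ih =>
    rw [Finset.sum_range_succ]
    refine le_trans ?_ (Nat.add_le_add_right ih _)
    refine le_trans (cnt_mono ?_) (cnt_union_le _ _ _)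
    rintro n - - ⟨m, hm, hn⟩
    rcases Nat.lt_succ_iff_lt_or_eq.1 hm with h | rfl
    · exact Or.inl ⟨m, h, hn⟩
    · exact Or.inr hn

theorem cnt_interval_le {a b : ℝ} (ha : 0 ≤ a) (hab : a ≤ b) (N : ℕ) :
    (cnt {n : ℕ | a ≤ n ∧ (n : ℝ) < b} N : ℝ) ≤ b - a + 1 := by
  have h1 : cnt {n : ℕ | a ≤ n ∧ (n : ℝ) < b} N ≤ (Finset.Ico ⌈a⌉₊ ⌈b⌉₊).card := by
    rw [← Set.ncard_coe_finset]
    refine Set.ncard_le_ncard ?_ (Finset.finite_toSet _)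
    rintro n ⟨⟨h1, h2⟩, -⟩
    simp only [Finset.coe_Ico, Set.mem_Ico]
    exact ⟨Nat.ceil_le.2 h1, Nat.lt_ceil.2 h2⟩
  rw [Nat.card_Ico] at h1
  have h2 : ⌈a⌉₊ ≤ ⌈b⌉₊ := Nat.ceil_mono hab
  have h3 : ((⌈b⌉₊ - ⌈a⌉₊ : ℕ) : ℝ) = ⌈b⌉₊ - ⌈a⌉₊ := by push_cast [h2]; ring
  have h4 : (cnt {n : ℕ | a ≤ n ∧ (n : ℝ) < b} N : ℝ) ≤ ((⌈b⌉₊ - ⌈a⌉₊ : ℕ) : ℝ) := by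
    exact_mod_cast h1
  have h5 := Nat.le_ceil a
  have h6 := Nat.ceil_lt_add_one (ha.trans hab)
  linarith

/-- The fractional part of `c * log n` lies in a short interval for few `n`. -/
theorem eventually_cnt_fract_log_le {c α δ : ℝ} (hc : 1 ≤ c) (hα : α ≤ 1) (hδ : 0 < δ)
    (hδ1 : δ ≤ 1) :
    ∀ᶠ N : ℕ in atTop, (cnt {n : ℕ | α ≤ Int.fract (c * Real.log n) ∧
      Int.fract (c * Real.log n) < α + δ} N : ℝ) ≤ 64 * δ * N := by
  have hc0 : 0 < c := by linarith
  have hlog : ∀ᶠ N : ℕ in atTop, c * Real.log N + 1 ≤ δ * N := by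
    have h := (Real.isLittleO_log_id_atTop.comp_tendsto
      (tendsto_natCast_atTop_atTop (R := ℝ))).def (c := δ / (2 * c)) (by positivity)
    filter_upwards [h, eventually_ge_atTop 1,
      (tendsto_natCast_atTop_atTop (R := ℝ)).eventually_ge_atTop (2 / δ)] with N hN hN1 hN2
    simp only [Function.comp, id, Real.norm_eq_abs, Nat.abs_cast] at hN
    have h1 := (le_abs_self _).trans hN
    rw [div_le_iff₀ hδ] at hN2
    have h2 : c * Real.log N ≤ c * (δ / (2 * c) * N) := by gcongr
    have h3 : c * (δ / (2 * c) * N) = δ * N / 2 := by field_simp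
    linarith
  filter_upwards [hlog, eventually_ge_atTop 1] with N hN hN1
  have hN0 : (0 : ℝ) < N := by exact_mod_cast hN1
  have hlogN : 0 ≤ Real.log N := Real.log_natCast_nonneg N
  set M := ⌊c * Real.log N⌋₊ with hM
  have hMle : (M : ℝ) ≤ c * Real.log N := Nat.floor_le (by positivity)
  -- The n with integer part m lie in `A m`, an interval of length at most 6δ times the gap from
  -- e^(m/c) to e^((m+1)/c). The gaps telescope to at most 3N, and the endpoint errors total M + 1 ≤
  -- δN.
  let A : ℕ → Set ℕ := fun m => {n : ℕ | Real.exp ((m + α) / c) ≤ n ∧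
    (n : ℝ) < Real.exp ((m + α + δ) / c)}
  have hcover : cnt {n : ℕ | α ≤ Int.fract (c * Real.log n) ∧
      Int.fract (c * Real.log n) < α + δ} N ≤ ∑ m ∈ Finset.range (M + 1), cnt (A m) N := by
    refine le_trans (cnt_mono ?_) (cnt_biUnion_le A (M + 1) N)
    rintro n hn1 hn2 ⟨h1, h2⟩
    have hn0 : (0 : ℝ) < n := by exact_mod_cast hn1
    have hl : 0 ≤ c * Real.log n := mul_nonneg hc0.le (Real.log_natCast_nonneg n)
    have hle : c * Real.log n ≤ c * Real.log N := by
      gcongr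
    have hfl : ((⌊c * Real.log n⌋₊ : ℕ) : ℝ) = (⌊c * Real.log n⌋ : ℝ) := by
      exact natCast_floor_eq_intCast_floor hl
    have hfr : Int.fract (c * Real.log n) = c * Real.log n - ⌊c * Real.log n⌋₊ := by
      rw [hfl]; exact (Int.self_sub_floor _).symm
    rw [hfr] at h1 h2
    refine ⟨⌊c * Real.log n⌋₊, Nat.lt_succ_of_le (Nat.floor_mono hle), ?_, ?_⟩
    · rw [← Real.le_log_iff_exp_le hn0, div_le_iff₀ hc0]
      linarith
    · rw [← Real.log_lt_iff_lt_exp hn0, lt_div_iff₀ hc0]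
      linarith
  have hone : ∀ m ∈ Finset.range (M + 1), (cnt (A m) N : ℝ) ≤
      6 * δ * (Real.exp (((m + 1 : ℕ) : ℝ) / c) - Real.exp ((m : ℝ) / c)) + 1 := by
    intro m _
    refine (cnt_interval_le (Real.exp_pos _).le (Real.exp_le_exp.2
      (div_le_div_of_nonneg_right (by linarith) hc0.le)) N).trans ?_
    gcongr
    have hcpos : 0 < 1 / c := by positivity
    have e1 : Real.exp ((m + α + δ) / c) - Real.exp ((m + α) / c) =
        Real.exp (m / c) * (Real.exp (α / c) * (Real.exp (δ / c) - 1)) := by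
      rw [mul_sub, mul_sub, ← Real.exp_add, ← Real.exp_add]
      rw [mul_one, ← Real.exp_add]
      congr 2 <;> ring
    have e2 : Real.exp (((m + 1 : ℕ) : ℝ) / c) - Real.exp ((m : ℝ) / c) =
        Real.exp (m / c) * (Real.exp (1 / c) - 1) := by
      rw [mul_sub, mul_one, ← Real.exp_add]
      push_cast
      congr 2; ring
    rw [e1, e2]
    have h1 : Real.exp (α / c) ≤ 3 := by
      have : α / c ≤ 1 := by rw [div_le_one hc0]; linarith
      exact (Real.exp_le_exp.2 this).trans (by linarith [Real.exp_one_lt_d9])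
    have h2 : Real.exp (δ / c) - 1 ≤ 2 * (δ / c) := by
      have hx : |δ / c| ≤ 1 := by
        rw [abs_of_pos (by positivity), div_le_one hc0]; linarith
      have := Real.abs_exp_sub_one_le hx
      rw [abs_of_pos (by positivity : 0 < δ / c)] at this
      exact (le_abs_self _).trans this
    have h3 : 1 / c ≤ Real.exp (1 / c) - 1 := by linarith [Real.add_one_le_exp (1 / c)]
    have h4 : 0 ≤ Real.exp (δ / c) - 1 := by
      have := Real.add_one_le_exp (δ / c)
      have : 0 < δ / c := by positivity
      linarith
    calc Real.exp (m / c) * (Real.exp (α / c) * (Real.exp (δ / c) - 1))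
        ≤ Real.exp (m / c) * (3 * (2 * (δ / c))) := by gcongr
      _ = 6 * δ * (Real.exp (m / c) * (1 / c)) := by ring
      _ ≤ 6 * δ * (Real.exp (m / c) * (Real.exp (1 / c) - 1)) := by gcongr
  have hsum : (cnt {n : ℕ | α ≤ Int.fract (c * Real.log n) ∧
      Int.fract (c * Real.log n) < α + δ} N : ℝ) ≤
      6 * δ * (Real.exp (((M + 1 : ℕ) : ℝ) / c) - Real.exp (((0 : ℕ) : ℝ) / c)) + (M + 1) := by
    calc _ ≤ ((∑ m ∈ Finset.range (M + 1), cnt (A m) N : ℕ) : ℝ) := by exact_mod_cast hcover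
      _ = ∑ m ∈ Finset.range (M + 1), (cnt (A m) N : ℝ) := by push_cast; rfl
      _ ≤ _ := Finset.sum_le_sum hone
      _ = _ := by
        rw [Finset.sum_add_distrib, ← Finset.mul_sum,
          Finset.sum_range_sub (fun m : ℕ => Real.exp ((m : ℝ) / c))]
        simp
  have hexp : Real.exp (((M + 1 : ℕ) : ℝ) / c) ≤ 3 * N := by
    calc Real.exp (((M + 1 : ℕ) : ℝ) / c) ≤ Real.exp (1 + Real.log N) := by
          apply Real.exp_le_exp.2
          rw [div_le_iff₀ hc0]
          push_cast
          nlinarith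
      _ = Real.exp 1 * N := by rw [Real.exp_add, Real.exp_log hN0]
      _ ≤ 3 * N := by gcongr; linarith [Real.exp_one_lt_d9]
  have h0 : 0 ≤ Real.exp (((0 : ℕ) : ℝ) / c) := (Real.exp_pos _).le
  have : 6 * δ * (Real.exp (((M + 1 : ℕ) : ℝ) / c) - Real.exp (((0 : ℕ) : ℝ) / c)) ≤
      6 * δ * (3 * N) := by
    gcongr
    linarith
  nlinarith [mul_pos hδ hN0]

/-! ### Gluing along a slowly growing index -/

/-- A sequence of functions, consecutive members of which agree off sets of smaller and smaller
upper density, glued along a slowly growing index. -/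
theorem exists_glue {α : Type*} (F : ℕ → ℕ → α) {e : ℕ → ℝ} (he : Tendsto e atTop (𝓝 0))
    (hF : ∀ i, ∀ᶠ N : ℕ in atTop, (cnt {n | F i n ≠ F (i + 1) n} N : ℝ) ≤ e i * N)
    {P : ℕ → ℕ → Prop} (hP : ∀ i, ∀ᶠ N in atTop, P i N) :
    ∃ (h : ℕ → α) (ι : ℕ → ℕ), Tendsto ι atTop atTop ∧ (∀ᶠ N in atTop, P (ι N) N) ∧
      ∀ (L : ℕ) (ε : ℝ), 0 < ε →
        ∀ᶠ N : ℕ in atTop, (cnt {n | h n ≠ F (ι N) n} (L * N) : ℝ) ≤ ε * N := by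
  have hex : ∀ i, ∃ M : ℕ, ∀ N ≥ M,
      (cnt {n | F i n ≠ F (i + 1) n} N : ℝ) ≤ e i * N ∧ P i N := fun i =>
    eventually_atTop.1 ((hF i).and (hP i))
  choose M hM using hex
  -- The factor i + 2 does two things when b (j+1) ≤ N < b (j+2): it makes b j negligible against N,
  -- and it keeps LN below b (j+3) once L is at most j + 4. Hence beyond b j only the indices j,
  -- j+1, j+2 occur up to LN.
  obtain ⟨b, hb_zero, hb_succ⟩ : ∃ b : ℕ → ℕ, b 0 = M 0 ∧
      ∀ i, b (i + 1) = max (M (i + 1)) ((i + 2) * (b i + 1)) :=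
    ⟨fun i => Nat.rec (M 0) (fun i bi => max (M (i + 1)) ((i + 2) * (bi + 1))) i, rfl,
      fun _ => rfl⟩
  have hbM : ∀ i, M i ≤ b i := by
    rintro (_ | i)
    · exact hb_zero.ge
    · rw [hb_succ]; exact le_max_left _ _
  have hbmul : ∀ i, (i + 2) * (b i + 1) ≤ b (i + 1) := fun i => by
    rw [hb_succ]; exact le_max_right _ _
  have hbmono : StrictMono b := strictMono_nat_of_lt_succ fun i => by
    have := hbmul i
    nlinarith
  -- Searching only up to n loses nothing, because i ≤ b i. The value 0 is also the default for n <
  -- b 0.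
  let ι : ℕ → ℕ := fun n => Nat.findGreatest (fun i => b i ≤ n) n
  have hι_ge : ∀ i n, b i ≤ n → i ≤ ι n := fun i n h =>
    Nat.le_findGreatest (P := fun i => b i ≤ n) ((hbmono.id_le i).trans h) h
  have hι_le : ∀ n, ι n ≠ 0 → b (ι n) ≤ n := fun n h =>
    (Nat.findGreatest_eq_iff.1 (rfl : ι n = ι n)).2.1 h
  have hι_lt : ∀ i n, n < b (i + 1) → ι n ≤ i := by
    intro i n h
    by_contra! hlt
    have h1 := hι_le n (by omega)
    have h2 := hbmono.monotone (show i + 1 ≤ ι n from hlt)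
    omega
  have hι : Tendsto ι atTop atTop :=
    tendsto_atTop.2 fun i => (eventually_ge_atTop (b i)).mono fun n hn => hι_ge i n hn
  refine ⟨fun n => F (ι n) n, ι, hι, ?_, fun L ε hε => ?_⟩
  · filter_upwards [hι.eventually_ge_atTop 1] with N hN
    exact (hM _ _ ((hbM _).trans (hι_le N (by omega)))).2
  have hpos : (0 : ℝ) < ε / (3 * (L + 1)) := by positivity
  have he1 := ((tendsto_add_atTop_iff_nat (f := e) 0).2 he).eventually_le_const hpos
  have h1 := hι.eventually he1
  have h2 := (hι.comp tendsto_id).eventually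
    ((he.comp (tendsto_sub_atTop_nat 1)).eventually_le_const hpos)
  have h3 := hι.eventually ((tendsto_one_div_add_atTop_nhds_zero_nat (𝕜 := ℝ)).eventually_le_const
    (by positivity : 0 < ε / 3))
  filter_upwards [h1, h2, h3, hι.eventually_ge_atTop (L + 2)] with N h1 h2 h3 hN
  obtain ⟨j, hj⟩ : ∃ j, ι N = j + 1 := ⟨ι N - 1, by omega⟩
  simp only [Function.comp, id, hj, Nat.add_zero, Nat.add_sub_cancel] at h1 h2 h3 hN ⊢
  have hbN : b (j + 1) ≤ N := hj ▸ hι_le N (by omega)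
  have hNb : N < b (j + 2) := by
    by_contra! h
    have := hι_ge _ _ h
    omega
  have hsub : cnt {n | F (ι n) n ≠ F (j + 1) n} (L * N) ≤
      cnt {n | n < b j} (L * N) + (cnt {n | F j n ≠ F (j + 1) n} (L * N) +
        cnt {n | F (j + 1) n ≠ F (j + 1 + 1) n} (L * N)) := by
    refine (cnt_mono ?_).trans ((cnt_union_le _ _ _).trans
      (Nat.add_le_add_left (cnt_union_le _ _ _) _))
    intro n _ hn hne
    by_cases hlt : n < b j
    · exact Or.inl hlt
    refine Or.inr ?_
    have hge := hι_ge j n (not_lt.1 hlt)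
    have hle : ι n ≤ j + 2 := by
      apply hι_lt
      have := hbmul (j + 2)
      calc n ≤ L * N := hn
        _ ≤ (j + 2 + 2) * b (j + 2) := by gcongr; omega
        _ < (j + 2 + 2) * (b (j + 2) + 1) := by
          apply Nat.mul_lt_mul_of_pos_left <;> omega
        _ ≤ _ := this
    rcases (by omega : ι n = j ∨ ι n = j + 1 ∨ ι n = j + 2) with h | h | h
    · left
      simpa [h] using hne
    · simp [h] at hne
    · right
      simp only [Set.mem_ofPred_eq, h] at hne
      exact fun heq => hne heq.symm
  rcases Nat.eq_zero_or_pos L with rfl | hL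
  · simp only [zero_mul, cnt]
    simp only [Nat.lt_one_iff, pos_of_gt, not_le, Set.Icc_eq_empty, Set.inter_empty,
      Set.ncard_empty, Nat.cast_zero]
    positivity
  have hLN : b (j + 1) ≤ L * N := hbN.trans (Nat.le_mul_of_pos_left N hL)
  have hA := (hM j (L * N) ((hbM j).trans ((hbmono.monotone (Nat.le_succ j)).trans hLN))).1
  have hB := (hM (j + 1) (L * N) ((hbM (j + 1)).trans hLN)).1
  have hC : (cnt {n | n < b j} (L * N) : ℝ) ≤ b j := by exact_mod_cast cnt_lt _ _
  have hD : (b j : ℝ) ≤ ε / 3 * N := by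
    have h4 : ((j : ℝ) + 2) * (b j + 1) ≤ N := by exact_mod_cast (hbmul j).trans hbN
    have h5 : (b j : ℝ) ≤ 1 / ((j + 1 : ℕ) + 1 : ℝ) * N := by
      rw [one_div, ← div_eq_inv_mul, le_div_iff₀ (by positivity)]
      push_cast
      nlinarith
    exact h5.trans (by gcongr)
  have hE : ∀ x : ℝ, x ≤ ε / (3 * (L + 1)) → x * ((L * N : ℕ) : ℝ) ≤ ε / 3 * N := by
    intro x hx
    calc x * ((L * N : ℕ) : ℝ) ≤ ε / (3 * (L + 1)) * ((L * N : ℕ) : ℝ) := by gcongr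
      _ = ε / 3 * N * (L / (L + 1)) := by push_cast; field_simp
      _ ≤ ε / 3 * N * 1 := by
        gcongr
        rw [div_le_one (by positivity)]
        linarith
      _ = _ := mul_one _
  have hsub' : (cnt {n | F (ι n) n ≠ F (j + 1) n} (L * N) : ℝ) ≤
      cnt {n | n < b j} (L * N) + (cnt {n | F j n ≠ F (j + 1) n} (L * N) +
        cnt {n | F (j + 1) n ≠ F (j + 1 + 1) n} (L * N)) := by exact_mod_cast hsub
  have := hE _ h1
  have := hE _ h2
  linarith

/-! ### Interpolation between two scales -/

section Interpolation

variable {G : Type*} [CommGroup G]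

/-- The interpolation, as `s` runs from `k` to `k + 1`, between the powers of `γ` to the exponents
`⌊c k * x⌋` and `⌊c (k + 1) * x⌋`. -/
noncomputable def blend (γ : G) (c : ℕ → ℝ) (s x : ℝ) : G :=
  if Int.fract s ≤ Int.fract (c ⌊s⌋₊ * x) then γ ^ ⌊c ⌊s⌋₊ * x⌋ else γ ^ ⌊c (⌊s⌋₊ + 1) * x⌋

theorem floor_eq_of_near {ε x y : ℝ} {m : ℤ} (h1 : ε ≤ Int.fract x) (h2 : Int.fract x < 1 - ε)
    (h : |y - x - m| < ε) : ⌊y⌋ = ⌊x⌋ + m ∧ |Int.fract y - Int.fract x| < ε := by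
  have hx := Int.self_sub_floor x
  rw [abs_lt] at h
  have hy : ⌊y⌋ = ⌊x⌋ + m := by
    rw [Int.floor_eq_iff]
    push_cast
    constructor <;> linarith
  refine ⟨hy, ?_⟩
  have hy' := Int.self_sub_floor y
  rw [hy] at hy'
  push_cast at hy'
  rw [abs_lt]
  constructor <;> linarith

/-- The `n` at which a perturbation of size `ε` of `c ⌊s⌋ * log n` or of `c (⌊s⌋ + 1) * log n` may
change the shape of `blend`. -/
def exceptional (c : ℕ → ℝ) (s ε : ℝ) : Set ℕ :=
  let I : ℕ → ℝ → ℝ → Set ℕ := fun k α δ =>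
    {n : ℕ | α ≤ Int.fract (c k * Real.log n) ∧ Int.fract (c k * Real.log n) < α + δ}
  (I ⌊s⌋₊ 0 ε ∪ I ⌊s⌋₊ (1 - ε) ε) ∪ (I (⌊s⌋₊ + 1) 0 ε ∪ I (⌊s⌋₊ + 1) (1 - ε) ε) ∪
    I ⌊s⌋₊ (Int.fract s - ε) (2 * ε)

/-- Four intervals of length ε and one of length 2ε, at 64 per unit length, give 384. -/
theorem eventually_cnt_exceptional_le {c : ℕ → ℝ} (hc : ∀ k, 1 ≤ c k) (s : ℝ) {ε : ℝ} (hε : 0 < ε)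
    (hε1 : ε ≤ 1 / 2) :
    ∀ᶠ N : ℕ in atTop, (cnt (exceptional c s ε) N : ℝ) ≤ 384 * ε * N := by
  have hs := Int.fract_lt_one s
  filter_upwards [
    eventually_cnt_fract_log_le (α := 0) (hc ⌊s⌋₊) (by linarith) hε (by linarith),
    eventually_cnt_fract_log_le (α := 1 - ε) (hc ⌊s⌋₊) (by linarith) hε (by linarith),
    eventually_cnt_fract_log_le (α := 0) (hc (⌊s⌋₊ + 1)) (by linarith) hε (by linarith),
    eventually_cnt_fract_log_le (α := 1 - ε) (hc (⌊s⌋₊ + 1)) (by linarith) hε (by linarith),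
    eventually_cnt_fract_log_le (α := Int.fract s - ε) (δ := 2 * ε) (hc ⌊s⌋₊) (by linarith)
      (by linarith) (by linarith)] with N h1 h2 h3 h4 h5
  have h : cnt (exceptional c s ε) N ≤ _ :=
    (cnt_union_le _ _ N).trans (Nat.add_le_add_right ((cnt_union_le _ _ N).trans
      (Nat.add_le_add (cnt_union_le _ _ N) (cnt_union_le _ _ N))) _)
  have h' := (Nat.cast_le (α := ℝ)).2 h
  push_cast at h'
  linarith

/-- Off the exceptional set the two floors change by exactly m and m', and the fractional part stays
on its side of the threshold. The same branch is therefore used at n and n', and either branch is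
multiplied by x. -/
theorem blend_eq_mul {γ : G} {c : ℕ → ℝ} {s ε : ℝ} {n n' : ℕ} (hn : n ∉ exceptional c s ε)
    {m m' : ℤ} (hm : |c ⌊s⌋₊ * Real.log n' - c ⌊s⌋₊ * Real.log n - m| < ε)
    (hm' : |c (⌊s⌋₊ + 1) * Real.log n' - c (⌊s⌋₊ + 1) * Real.log n - m'| < ε) {x : G}
    (hx : γ ^ m = x) (hx' : γ ^ m' = x) :
    blend γ c s (Real.log n') = x * blend γ c s (Real.log n) := by
  simp only [exceptional, Set.mem_union, Set.mem_ofPred_eq, not_or, not_and, not_lt] at hn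
  obtain ⟨⟨⟨h1, h2⟩, h3, h4⟩, h5⟩ := hn
  have f0 := Int.fract_nonneg (c ⌊s⌋₊ * Real.log n)
  have f1 := Int.fract_lt_one (c ⌊s⌋₊ * Real.log n)
  have g0 := Int.fract_nonneg (c (⌊s⌋₊ + 1) * Real.log n)
  have g1 := Int.fract_lt_one (c (⌊s⌋₊ + 1) * Real.log n)
  have a1 := h1 f0
  have a2 : Int.fract (c ⌊s⌋₊ * Real.log n) < 1 - ε := by
    by_contra! h; linarith [h2 h]
  have b1 := h3 g0
  have b2 : Int.fract (c (⌊s⌋₊ + 1) * Real.log n) < 1 - ε := by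
    by_contra! h; linarith [h4 h]
  obtain ⟨u1, u2⟩ := floor_eq_of_near (by linarith) a2 hm
  obtain ⟨v1, -⟩ := floor_eq_of_near (by linarith) b2 hm'
  have hiff : Int.fract s ≤ Int.fract (c ⌊s⌋₊ * Real.log n') ↔
      Int.fract s ≤ Int.fract (c ⌊s⌋₊ * Real.log n) := by
    rw [abs_lt] at u2
    constructor
    · intro h
      linarith [h5 (by linarith)]
    · intro h
      linarith [h5 (by linarith)]
  unfold blend
  simp only [hiff, u1, v1, zpow_add, hx, hx']
  split_ifs <;> exact mul_comm _ _

/-- Only n whose fractional part lies between the old and new thresholds can change. If s passes an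
integer, then off the first interval the branch at s is already the one for the next scale, and off
the second the branch at s' is that one too. -/
theorem eventually_cnt_blend_ne_le (γ : G) {c : ℕ → ℝ} (hc : ∀ k, 1 ≤ c k) {s s' : ℝ}
    (hs : 0 ≤ s) (hlt : s < s') (hle : s' ≤ s + 1) :
    ∀ᶠ N : ℕ in atTop, (cnt {n : ℕ | blend γ c s (Real.log n) ≠ blend γ c s' (Real.log n)} N : ℝ) ≤
      128 * (s' - s) * N := by
  have hd : 0 < s' - s := by linarith
  filter_upwards [
    eventually_cnt_fract_log_le (α := Int.fract s) (hc ⌊s⌋₊) (Int.fract_lt_one s).le hd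
      (by linarith),
    eventually_cnt_fract_log_le (α := 0) (hc (⌊s⌋₊ + 1)) zero_le_one hd (by linarith)] with N h1 h2
  have hfl : ((⌊s⌋₊ : ℕ) : ℝ) = s - Int.fract s := by
    rw [natCast_floor_eq_intCast_floor hs]
    exact (Int.self_sub_fract s).symm
  have hfl' : ((⌊s'⌋₊ : ℕ) : ℝ) = s' - Int.fract s' := by
    rw [natCast_floor_eq_intCast_floor (by linarith)]
    exact (Int.self_sub_fract s').symm
  have hcases : ⌊s'⌋₊ = ⌊s⌋₊ ∨ ⌊s'⌋₊ = ⌊s⌋₊ + 1 := by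
    have h3 : ⌊s⌋₊ ≤ ⌊s'⌋₊ := Nat.floor_mono hlt.le
    have h4 : ⌊s'⌋₊ ≤ ⌊s⌋₊ + 1 := by
      rw [← Nat.floor_add_one hs]
      exact Nat.floor_mono hle
    omega
  have hsub := (cnt_mono (N := N) (A := {n : ℕ | blend γ c s (Real.log n) ≠
    blend γ c s' (Real.log n)}) ?_).trans (cnt_union_le {n : ℕ | Int.fract s ≤
      Int.fract (c ⌊s⌋₊ * Real.log n) ∧ Int.fract (c ⌊s⌋₊ * Real.log n) <
        Int.fract s + (s' - s)} {n : ℕ | 0 ≤ Int.fract (c (⌊s⌋₊ + 1) * Real.log n) ∧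
      Int.fract (c (⌊s⌋₊ + 1) * Real.log n) < 0 + (s' - s)} N)
  · have h' := (Nat.cast_le (α := ℝ)).2 hsub
    push_cast at h'
    linarith
  · intro n _ _ hn
    by_contra hnot
    simp only [Set.mem_union, Set.mem_ofPred_eq, not_or, not_and, not_lt] at hnot
    obtain ⟨k1, k2⟩ := hnot
    apply hn
    have f1 := Int.fract_lt_one (c ⌊s⌋₊ * Real.log n)
    have k2' := k2 (Int.fract_nonneg _)
    rcases hcases with h | h
    · have hfr : Int.fract s' = Int.fract s + (s' - s) := by rw [h] at hfl'; linarith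
      unfold blend
      rw [h, hfr]
      have : Int.fract s ≤ Int.fract (c ⌊s⌋₊ * Real.log n) ↔
          Int.fract s + (s' - s) ≤ Int.fract (c ⌊s⌋₊ * Real.log n) :=
        ⟨k1, fun h => by linarith⟩
      simp only [this]
    · have hfr : Int.fract s' = Int.fract s + (s' - s) - 1 := by
        rw [h] at hfl'; push_cast at hfl'; linarith
      have hfs := Int.fract_lt_one s
      unfold blend
      rw [if_neg, if_pos]
      · rw [h]
      · rw [h, hfr]; linarith
      · intro h3
        have := k1 h3
        have := Int.fract_nonneg s'
        linarith

end Interpolation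

/-! ### Construction of the twisted function -/

theorem tendsto_sqrt_succ_sub_sqrt :
    Tendsto (fun i : ℕ => √((i + 1 : ℕ) : ℝ) - √(i : ℝ)) atTop (𝓝 0) := by
  have hsq : Tendsto (fun i : ℕ => √(i : ℝ)) atTop atTop :=
    Real.tendsto_sqrt_atTop.comp tendsto_natCast_atTop_atTop
  refine squeeze_zero' (Eventually.of_forall fun i => ?_) ?_ hsq.inv_tendsto_atTop
  · rw [sub_nonneg]
    gcongr
    exact Nat.le_succ i
  · filter_upwards [eventually_gt_atTop 0] with i hi
    have h0 : 0 < √(i : ℝ) := Real.sqrt_pos.2 (by exact_mod_cast hi)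
    have h1 : √((i + 1 : ℕ) : ℝ) ≤ √(i : ℝ) + (√(i : ℝ))⁻¹ := by
      rw [Real.sqrt_le_left (by positivity), add_sq, Real.sq_sqrt (by positivity),
        mul_assoc, mul_inv_cancel₀ h0.ne']
      push_cast
      have : 0 ≤ ((√(i : ℝ))⁻¹) ^ 2 := by positivity
      linarith
    simp only [Pi.inv_apply]
    linarith

section Twisted

variable {G : Type*} [CommGroup G]

theorem cnt_blend_mul_le {γ : G} {c : ℕ → ℝ} {s ε : ℝ} {p : ℕ} (hp : 0 < p) {x : G}
    (h : ∀ k, ⌊s⌋₊ ≤ k → ∃ m : ℤ, γ ^ m = x ∧ |c k * Real.log p - m| < ε) (N : ℕ) :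
    cnt {n : ℕ | blend γ c s (Real.log (p * n : ℕ)) ≠ x * blend γ c s (Real.log n)} N ≤
      cnt (exceptional c s ε) N := by
  refine cnt_mono fun n hn1 _ hn => ?_
  by_contra hnot
  obtain ⟨m, hm, hm1⟩ := h ⌊s⌋₊ le_rfl
  obtain ⟨m', hm', hm1'⟩ := h (⌊s⌋₊ + 1) (Nat.le_succ _)
  have hlog : Real.log (p * n : ℕ) = Real.log p + Real.log n := by
    have hp0 : (p : ℝ) ≠ 0 := by positivity
    have hn0 : (n : ℝ) ≠ 0 := by positivity
    rw [Nat.cast_mul, Real.log_mul hp0 hn0]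
  refine hn (blend_eq_mul hnot ?_ ?_ hm hm')
  · rw [hlog, mul_add, add_sub_cancel_right]; exact hm1
  · rw [hlog, mul_add, add_sub_cancel_right]; exact hm1'

theorem eventually_cnt_blend_succ_le (γ : G) {c : ℕ → ℝ} (hc : ∀ k, 1 ≤ c k) (s : ℝ) {ε : ℝ}
    (hε : 0 < ε) (hε1 : ε ≤ 1 / 2) :
    ∀ᶠ N : ℕ in atTop, (cnt {n : ℕ | blend γ c s (Real.log (n + 1 : ℕ)) ≠
      blend γ c s (Real.log n)} N : ℝ) ≤ 385 * ε * N := by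
  -- For n ≥ K both scales move by at most c/n < ε between n and n + 1, so `blend_eq_mul` applies
  -- with exponent 0. The n < K add the extra ε in 385.
  obtain ⟨K, hK⟩ := exists_nat_gt ((c ⌊s⌋₊ + c (⌊s⌋₊ + 1)) / ε)
  filter_upwards [eventually_cnt_exceptional_le hc s hε hε1,
    null_iff.1 (null_lt K) ε hε] with N h1 h2
  have hsub : cnt {n : ℕ | blend γ c s (Real.log (n + 1 : ℕ)) ≠ blend γ c s (Real.log n)} N ≤
      cnt (exceptional c s ε) N + cnt {n | n < K} N := by
    refine (cnt_mono fun n hn1 _ hn => ?_).trans (cnt_union_le _ _ _)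
    by_contra hnot
    simp only [Set.mem_union, Set.mem_ofPred_eq, not_or, not_lt] at hnot
    obtain ⟨hnot, hKn⟩ := hnot
    have hn0 : (0 : ℝ) < n := by exact_mod_cast hn1
    have hlog : Real.log (n + 1 : ℕ) - Real.log n ≤ 1 / n := by
      rw [← Real.log_div (by positivity) hn0.ne']
      have := Real.log_le_sub_one_of_pos (show 0 < ((n + 1 : ℕ) : ℝ) / n by positivity)
      refine this.trans_eq ?_
      push_cast
      field_simp
      ring
    have hlog0 : 0 ≤ Real.log (n + 1 : ℕ) - Real.log n := by
      rw [sub_nonneg]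
      gcongr
      exact Nat.le_succ n
    have hsmall : ∀ k, c k ≤ c ⌊s⌋₊ + c (⌊s⌋₊ + 1) →
        |c k * Real.log (n + 1 : ℕ) - c k * Real.log n - (0 : ℤ)| < ε := by
      intro k hk
      have hck : 0 < c k := by linarith [hc k]
      have hKn' : (K : ℝ) ≤ n := by exact_mod_cast hKn
      rw [div_lt_iff₀ hε] at hK
      rw [Int.cast_zero, sub_zero, ← mul_sub, abs_of_nonneg (mul_nonneg hck.le hlog0)]
      calc c k * (Real.log (n + 1 : ℕ) - Real.log n) ≤ c k * (1 / n) := by gcongr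
        _ = c k / n := by ring
        _ < ε := by
          rw [div_lt_iff₀ hn0]
          nlinarith
    apply hn
    rw [blend_eq_mul hnot (hsmall _ (by linarith [hc (⌊s⌋₊ + 1)])) (hsmall _ (by linarith [hc ⌊s⌋₊]))
      (zpow_zero γ) (zpow_zero γ), one_mul]
  have h' := (Nat.cast_le (α := ℝ)).2 hsub
  rw [Nat.cast_add] at h'
  linarith

/-- Every completely multiplicative function into a finite cyclic group is, up to sets of density
zero, the multiplier of a locally constant function. -/
theorem exists_twisted [Finite G] {γ : G} (hγ : ∀ x, x ∈ Subgroup.zpowers γ) {X : ℕ → G}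
    (hX : ∀ m n, 0 < m → 0 < n → X (m * n) = X m * X n) :
    ∃ h : ℕ → G, (∀ p, p.Prime → Null {n | h (p * n) ≠ X p * h n}) ∧
      Null {n | h (n + 1) ≠ h n} := by
  have hex : ∀ k : ℕ, ∃ c : ℝ, 1 ≤ c ∧ ∀ p ∈ (Finset.range (k + 1)).filter Nat.Prime,
      ∃ m : ℤ, γ ^ m = X p ∧ |c * Real.log p - m| < 1 / (k + 2) := fun k =>
    exists_scale hγ hX _ (fun p hp => (Finset.mem_filter.1 hp).2) (by positivity)
  choose c hc hcp using hex
  -- The square root tends to infinity with increments at most 1 and tending to 0, so consecutive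
  -- members of `F` differ on sets of vanishing upper density.
  let s : ℕ → ℝ := fun i => √(i : ℝ)
  let ε : ℕ → ℝ := fun i => 1 / (⌊s i⌋₊ + 2)
  have hε0 : ∀ i, 0 < ε i := fun i => by positivity
  have hε1 : ∀ i, ε i ≤ 1 / 2 := fun i => by
    simp only [ε]
    gcongr
    linarith [(Nat.cast_nonneg ⌊s i⌋₊ : (0 : ℝ) ≤ _)]
  have hfloor : Tendsto (fun i => ⌊s i⌋₊) atTop atTop :=
    tendsto_nat_floor_atTop.comp (Real.tendsto_sqrt_atTop.comp tendsto_natCast_atTop_atTop)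
  have hε : Tendsto ε atTop (𝓝 0) := by
    have h1 : Tendsto (fun k : ℕ => 1 / ((k : ℝ) + 2)) atTop (𝓝 0) := by
      simp only [one_div]
      exact (tendsto_atTop_add_const_right _ _ tendsto_natCast_atTop_atTop).inv_tendsto_atTop
    exact h1.comp hfloor
  let F : ℕ → ℕ → G := fun i n => blend γ c (s i) (Real.log n)
  have hF : ∀ i, ∀ᶠ N : ℕ in atTop, (cnt {n | F i n ≠ F (i + 1) n} N : ℝ) ≤
      128 * (√((i + 1 : ℕ) : ℝ) - √(i : ℝ)) * N := fun i => by
    refine eventually_cnt_blend_ne_le γ hc (Real.sqrt_nonneg _) ?_ ?_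
    · exact Real.sqrt_lt_sqrt (by positivity) (by push_cast; linarith)
    · simp only [s]
      rw [Real.sqrt_le_left (by positivity), add_sq, Real.sq_sqrt (by positivity)]
      push_cast
      have := Real.sqrt_nonneg (i : ℝ)
      linarith
  let P : ℕ → ℕ → Prop := fun i N =>
    (∀ p, p.Prime → p ≤ ⌊s i⌋₊ →
      (cnt {n | F i (p * n) ≠ X p * F i n} N : ℝ) ≤ 385 * ε i * N) ∧
    (cnt {n | F i (n + 1) ≠ F i n} N : ℝ) ≤ 385 * ε i * N
  have hP : ∀ i, ∀ᶠ N in atTop, P i N := by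
    intro i
    filter_upwards [eventually_cnt_exceptional_le hc (s i) (hε0 i) (hε1 i),
      eventually_cnt_blend_succ_le γ hc (s i) (hε0 i) (hε1 i)] with N h1 h2
    refine ⟨fun p hp hpi => ?_, h2⟩
    have h3 : (cnt {n | F i (p * n) ≠ X p * F i n} N : ℝ) ≤ cnt (exceptional c (s i) (ε i)) N := by
      refine Nat.cast_le.2 (cnt_blend_mul_le hp.pos (fun k hk => ?_) N)
      obtain ⟨m, hm, hm1⟩ := hcp k p (by simp [hp]; omega)
      refine ⟨m, hm, hm1.trans_le ?_⟩
      simp only [ε]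
      gcongr
    have : 0 ≤ ε i * N := mul_nonneg (hε0 i).le (Nat.cast_nonneg _)
    linarith
  have he : Tendsto (fun i : ℕ => 128 * (√((i + 1 : ℕ) : ℝ) - √(i : ℝ))) atTop (𝓝 0) := by
    simpa using tendsto_sqrt_succ_sub_sqrt.const_mul 128
  obtain ⟨h, ι, hι, hPι, hh⟩ := exists_glue F he hF hP
  have hsmall : ∀ η : ℝ, 0 < η → ∀ᶠ N in atTop, 385 * ε (ι N) ≤ η := fun η hη => by
    have h1 : Tendsto (fun i => 385 * ε i) atTop (𝓝 0) := by simpa using hε.const_mul 385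
    exact (h1.comp hι).eventually_le_const hη
  refine ⟨h, fun p hp => null_iff.2 fun η hη => ?_, null_iff.2 fun η hη => ?_⟩
  -- Control of h(pn) for n ≤ N needs the gluing estimate up to pN; h(n+1) below needs it up to N +
  -- 1 ≤ 2N.
  · filter_upwards [hPι, hsmall (η / 3) (by positivity), hh p (η / 3) (by positivity),
      hh 1 (η / 3) (by positivity), (hfloor.comp hι).eventually_ge_atTop p] with N h1 h2 h3 h4 h5
    have hsub : cnt {n | h (p * n) ≠ X p * h n} N ≤
        cnt {n | h n ≠ F (ι N) n} (p * N) + (cnt {n | h n ≠ F (ι N) n} (1 * N) +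
          cnt {n | F (ι N) (p * n) ≠ X p * F (ι N) n} N) := by
      refine le_trans ?_ (Nat.add_le_add_right (cnt_mul_le hp.pos {n | h n ≠ F (ι N) n} N) _)
      rw [one_mul]
      refine (cnt_mono ?_).trans ((cnt_union_le _ _ N).trans
        (Nat.add_le_add_left (cnt_union_le _ _ N) _))
      intro n _ _ hn
      by_contra hcon
      simp only [Set.mem_union, Set.mem_ofPred_eq, not_or, not_not] at hcon
      obtain ⟨k1, k2, k3⟩ := hcon
      exact hn (by rw [k1, k2, k3])
    have h' := (Nat.cast_le (α := ℝ)).2 hsub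
    push_cast at h'
    have h6 := h1.1 p hp h5
    have h7 : 385 * ε (ι N) * N ≤ η / 3 * N := by gcongr
    linarith
  · filter_upwards [hPι, hsmall (η / 3) (by positivity), hh 2 (η / 3) (by positivity),
      hh 1 (η / 3) (by positivity), eventually_ge_atTop 1] with N h1 h2 h3 h4 h5
    have hsub : cnt {n | h (n + 1) ≠ h n} N ≤
        cnt {n | h n ≠ F (ι N) n} (2 * N) + (cnt {n | h n ≠ F (ι N) n} (1 * N) +
          cnt {n | F (ι N) (n + 1) ≠ F (ι N) n} N) := by
      refine le_trans ?_ (Nat.add_le_add_right ((cnt_add_le 1 {n | h n ≠ F (ι N) n} N).trans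
        (cnt_le_cnt_right _ (by omega : N + 1 ≤ 2 * N))) _)
      rw [one_mul]
      refine (cnt_mono ?_).trans ((cnt_union_le _ _ N).trans
        (Nat.add_le_add_left (cnt_union_le _ _ N) _))
      intro n _ _ hn
      by_contra hcon
      simp only [Set.mem_union, Set.mem_ofPred_eq, not_or, not_not] at hcon
      obtain ⟨k1, k2, k3⟩ := hcon
      exact hn (by rw [k1, k2, k3])
    have h' := (Nat.cast_le (α := ℝ)).2 hsub
    push_cast at h'
    have h6 := h1.2
    have h7 : 385 * ε (ι N) * N ≤ η / 3 * N := by gcongr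
    linarith

end Twisted

/-! ### Conclusion -/

theorem exists_stable_consecutiveInter_eq_empty {q : ℕ} (hq : q.Prime) :
    ∃ S : Set ℕ, IsStable S ∧ HasDensity S (1 - 1 / ((q : ℝ) - 1)) ∧ consecutiveInter S q = ∅ := by
  have : Fact q.Prime := ⟨hq⟩
  obtain ⟨γ, hγ⟩ := IsCyclic.exists_generator (α := (ZMod q)ˣ)
  -- The last digit of 0 is 0, not a unit. The value 1 there is arbitrary, as multiplicativity is
  -- needed only at positive integers.
  let X : ℕ → (ZMod q)ˣ := fun n =>
    if hn : n = 0 then 1 else Units.mk0 (lastDigit q n) (lastDigit_ne_zero hn)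
  have hXval : ∀ n, n ≠ 0 → (X n : ZMod q) = lastDigit q n := fun n hn => by simp [X, hn]
  have hX : ∀ m n, 0 < m → 0 < n → X (m * n) = X m * X n := fun m n hm hn => by
    ext
    rw [Units.val_mul, hXval _ (Nat.mul_pos hm hn).ne', hXval _ hm.ne', hXval _ hn.ne',
      lastDigit_mul]
  obtain ⟨h, hmul, hadd⟩ := exists_twisted hγ hX
  exact exists_stable_of_twisted hXval hmul hadd

end StableSet

theorem theorem1p4 (q : ℕ) (hq : q.Prime) :
    (∃ S : Set ℕ, StableSet.IsStable S ∧
      StableSet.HasDensity S (1 - 1 / ((q : ℝ) - 1)) ∧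
      StableSet.HasDensity (StableSet.consecutiveInter S q) 0) ∧
    (∃ S : Set ℕ, StableSet.IsStable S ∧
      StableSet.HasDensity S (1 - 1 / ((q : ℝ) - 1)) ∧
      StableSet.consecutiveInter S q = ∅) := by
  obtain ⟨S, h1, h2, h3⟩ := StableSet.exists_stable_consecutiveInter_eq_empty hq
  exact ⟨⟨S, h1, h2, h3 ▸ StableSet.null_empty⟩, S, h1, h2, h3⟩
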